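/- **Theorem.** Let $A\in\mathbb R^{n\times n}$, $G\in\mathbb R^{n\times q}$, $C\in\mathbb R^{p\times n}$, $H\in\mathbb R^{p\times p}$ with $\det H\neq 0$, let $h>0$, $\varepsilon\in(0,1]$, and put $$A_d=e^{Ah},\qquad G_d=\Big(\int_0^h e^{A\tau}GG^\top e^{A^\top\tau}\,d\tau\Big)^{1/2},\qquad M=HH^\top ,$$ where the square root is the positive semidefinite one. List the eigenvalues of $A$ with algebraic multiplicity as $\lambda_1(A),\dots,\lambda_n(A)$ with $\operatorname{Re}\lambda_1(A)\ge\dots\ge\operatorname{Re}\lambda_n(A)$, and let $r\in\{1,\dots,n-1\}$ satisfy $\operatorname{Re}\lambda_r(A)>\operatorname{Re}\lambda_{r+1}(A)$. Assume that $(A_d,G_d)$ is reachable and $(A_d,C)$ is observable (i.e. the reachability and observability matrices have rank $n$), and that $A$ has exactly $r'$ Hurwitz unstable eigenvalues, i.e. eigenvalues with $\operatorname{Re}\lambda\ge 0$, counted with algebraic multiplicity. Consider the Oja flow $\varepsilon\,\dot U=(I_n-UU^\top)AU$ on $\mathrm{St}(r,n)=\{U\in\mathbb R^{n\times r}: U^\top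 U=I_r\}$. A set $\mathcal S$ of equilibrium points in $\mathrm{St}(r,n)$ is called asymptotically stable if (i) for every neighbourhood $N$ of $\mathcal S$ there is a neighbourhood $N_0$ of $\mathcal S$ such that orbits starting in $N_0$ remain in $N$ for all $t\ge0$; (ii) all orbits starting in some neighbourhood of $\mathcal S$ converge to $\mathcal S$ as $t\to\infty$; and (iii) for every $V\in\mathcal S$ there are orbits starting arbitrarily close to, but different from, $V$ that converge to $V$. Let $\bar U$ belong to the stable equilibrium set of the Oja flow, i.e. to some asymptotically stable set of equilibrium points. Put $A_{\bar U}=\bar U^\top A_d\bar U$, $G_{\bar U}=\bar U^\top G_d$, $C_{\bar U}=C\bar U$, and for $R\in\mathbb R^{r\times r}$ let $F(R)=RC_{\bar U}^\top(C_{\bar U}RC_{\bar U}^\top+M)^{-1}$. Then the algebraic Riccati equation of the low-rank Kalman filter, $$R=A_{\bar U}\big(I_r-F(R)C_{\bar U}\big)RA_{\bar U}^\top+G_{\bar U}G_{\bar U}^\top ,$$ has exactly one positive definite solution $\tilde R$, and, with the steady-state gain $\tilde F=F(\tilde R)$, the steady-state closed-loop matrix $A_d(I_n-\bar U\tilde FC)$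 of the filter is Schur stable (all its complex eigenvalues have modulus less than $1$) if and only if $r\ge r'$. -/

import Mathlib

open scoped Matrix Topology

noncomputable section

namespace LowRankKalman

/-! ### Linear systems -/

/-- The eigenvalues of a real square matrix: the complex roots of its characteristic polynomial,
counted with algebraic multiplicity. -/
def eigenvalues {n : ℕ} (A : Matrix (Fin n) (Fin n) ℝ) : Multiset ℂ :=
  (A.map (algebraMap ℝ ℂ)).charpoly.roots

/-- `reEigenvalue A i` is the real part of the `i`-th eigenvalue of `A` (`i = 1, …, n`), the
eigenvalues being listed with algebraic multiplicity in order of decreasing real part. -/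
def reEigenvalue {n : ℕ} (A : Matrix (Fin n) (Fin n) ℝ) (i : ℕ) : ℝ :=
  (((eigenvalues A).map Complex.re).sort (· ≥ ·)).getD (i - 1) 0

open Classical in
/-- The number of Hurwitz unstable eigenvalues, that is, of eigenvalues outside the open left half
plane, counted with algebraic multiplicity. -/
def numHurwitzUnstable {n : ℕ} (A : Matrix (Fin n) (Fin n) ℝ) : ℕ :=
  (eigenvalues A).countP (fun z => 0 ≤ z.re)

/-- All complex eigenvalues lie in the open unit disc. -/
def IsSchurStable {n : ℕ} (B : Matrix (Fin n) (Fin n) ℝ) : Prop :=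
  ∀ z ∈ eigenvalues B, ‖z‖ < 1

/-- Full rank of the reachability matrix `[B, AB, …, A ^ (n - 1) B]`. -/
def IsReachable {n m : ℕ} (A : Matrix (Fin n) (Fin n) ℝ) (B : Matrix (Fin n) (Fin m) ℝ) : Prop :=
  (Matrix.of fun (i : Fin n) (kj : Fin n × Fin m) => (A ^ (kj.1 : ℕ) * B) i kj.2).rank = n

/-- Full rank of the observability matrix with block rows `C, CA, …, C A ^ (n - 1)`. -/
def IsObservable {n p : ℕ} (A : Matrix (Fin n) (Fin n) ℝ) (C : Matrix (Fin p) (Fin n) ℝ) : Prop :=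
  (Matrix.of fun (ki : Fin n × Fin p) (j : Fin n) => (C * A ^ (ki.1 : ℕ)) ki.2 j).rank = n

/-- The sampled state matrix `A_d = exp (A h)`. -/
def discA {n : ℕ} (A : Matrix (Fin n) (Fin n) ℝ) (h : ℝ) : Matrix (Fin n) (Fin n) ℝ :=
  NormedSpace.exp (h • A)

/-- The covariance `∫₀ʰ exp (A τ) G Gᵀ exp (Aᵀ τ) dτ` of the sampled process noise. -/
def noiseCov {n q : ℕ} (A : Matrix (Fin n) (Fin n) ℝ) (G : Matrix (Fin n) (Fin q) ℝ) (h : ℝ) :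
    Matrix (Fin n) (Fin n) ℝ :=
  Matrix.of fun i j =>
    ∫ τ in (0 : ℝ)..h, (NormedSpace.exp (τ • A) * G * Gᵀ * NormedSpace.exp (τ • Aᵀ)) i j

open scoped MatrixOrder in
/-- The sampled noise matrix `G_d`: the positive semidefinite square root of `noiseCov`. -/
def discG {n q : ℕ} (A : Matrix (Fin n) (Fin n) ℝ) (G : Matrix (Fin n) (Fin q) ℝ) (h : ℝ) :
    Matrix (Fin n) (Fin n) ℝ :=
  CFC.sqrt (noiseCov A G h)

/-! ### The Oja flow -/

/-- The Stiefel manifold `St(r, n)`. -/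
def stiefel (r n : ℕ) : Set (Matrix (Fin n) (Fin r) ℝ) :=
  {U | Uᵀ * U = 1}

/-- The right-hand side `(I - U Uᵀ) A U` of the Oja flow. -/
def ojaField {n r : ℕ} (A : Matrix (Fin n) (Fin n) ℝ) (U : Matrix (Fin n) (Fin r) ℝ) :
    Matrix (Fin n) (Fin r) ℝ :=
  (1 - U * Uᵀ) * A * U

/-- `U` is a solution on `[0, ∞)` of `ε U' = (I - U Uᵀ) A U` that starts on the Stiefel manifold. -/
def IsOjaOrbit {n r : ℕ} (A : Matrix (Fin n) (Fin n) ℝ) (ε : ℝ)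
    (U : ℝ → Matrix (Fin n) (Fin r) ℝ) : Prop :=
  U 0 ∈ stiefel r n ∧
    ∀ t, 0 ≤ t → ∀ i j,
      HasDerivWithinAt (fun s => U s i j) (ε⁻¹ * ojaField A (U t) i j) (Set.Ici 0) t

/-- The equilibrium points of the Oja flow on the Stiefel manifold. -/
def ojaEquilibria {n : ℕ} (r : ℕ) (A : Matrix (Fin n) (Fin n) ℝ) :
    Set (Matrix (Fin n) (Fin r) ℝ) :=
  {U | U ∈ stiefel r n ∧ ojaField A U = 0}

/-- Local asymptotic stability of a set `S` of equilibrium points of the Oja flow: orbits that start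
near `S` stay near `S` and converge to `S`, and each point of `S` is the limit of orbits which start
arbitrarily close to it, but not at it. -/
structure IsAsymptoticallyStable {n r : ℕ} (A : Matrix (Fin n) (Fin n) ℝ) (ε : ℝ)
    (S : Set (Matrix (Fin n) (Fin r) ℝ)) : Prop where
  subset_equilibria : S ⊆ ojaEquilibria r A
  stable : ∀ N ∈ 𝓝ˢ S, ∃ N₀ ∈ 𝓝ˢ S, ∀ U : ℝ → Matrix (Fin n) (Fin r) ℝ,
    IsOjaOrbit A ε U → U 0 ∈ N₀ → ∀ t, 0 ≤ t → U t ∈ N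
  attractive : ∃ N₀ ∈ 𝓝ˢ S, ∀ U : ℝ → Matrix (Fin n) (Fin r) ℝ,
    IsOjaOrbit A ε U → U 0 ∈ N₀ → Filter.Tendsto U Filter.atTop (𝓝ˢ S)
  limit_point : ∀ V ∈ S, ∀ N ∈ 𝓝 V, ∃ U : ℝ → Matrix (Fin n) (Fin r) ℝ,
    IsOjaOrbit A ε U ∧ U 0 ∈ N ∧ U 0 ≠ V ∧ Filter.Tendsto U Filter.atTop (𝓝 V)

/-- The stable equilibrium set of the Oja flow: the union of all asymptotically stable sets of
equilibrium points. -/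
def ojaStableSet {n : ℕ} (r : ℕ) (A : Matrix (Fin n) (Fin n) ℝ) (ε : ℝ) :
    Set (Matrix (Fin n) (Fin r) ℝ) :=
  {U | ∃ S, IsAsymptoticallyStable A ε S ∧ U ∈ S}

/-! ### The low-rank Kalman filter with constant `U` -/

/-- The low-rank Kalman gain `F = R C_Uᵀ (C_U R C_Uᵀ + M)⁻¹`, where `C_U = C U` and `M = H Hᵀ`. -/
def lowRankGain {n p r : ℕ} (C : Matrix (Fin p) (Fin n) ℝ) (H : Matrix (Fin p) (Fin p) ℝ)
    (U : Matrix (Fin n) (Fin r) ℝ) (R : Matrix (Fin r) (Fin r) ℝ) : Matrix (Fin r) (Fin p) ℝ :=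
  R * (C * U)ᵀ * ((C * U) * R * (C * U)ᵀ + H * Hᵀ)⁻¹

/-- One step `R ↦ A_U (I - F C_U) R A_Uᵀ + G_U G_Uᵀ` of the low-dimensional Riccati difference
equation, where `A_U = Uᵀ A_d U`, `G_U = Uᵀ G_d` and `C_U = C U`. -/
def lowRankRiccati {n p r : ℕ} (Ad Gd : Matrix (Fin n) (Fin n) ℝ) (C : Matrix (Fin p) (Fin n) ℝ)
    (H : Matrix (Fin p) (Fin p) ℝ) (U : Matrix (Fin n) (Fin r) ℝ) (R : Matrix (Fin r) (Fin r) ℝ) :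
    Matrix (Fin r) (Fin r) ℝ :=
  (Uᵀ * Ad * U) * (1 - lowRankGain C H U R * (C * U)) * R * (Uᵀ * Ad * U)ᵀ
    + (Uᵀ * Gd) * (Uᵀ * Gd)ᵀ

/-- `R` is a steady state of the low-rank filter: a positive definite solution of the
low-dimensional algebraic Riccati equation. -/
def IsSteadyState {n p r : ℕ} (Ad Gd : Matrix (Fin n) (Fin n) ℝ) (C : Matrix (Fin p) (Fin n) ℝ)
    (H : Matrix (Fin p) (Fin p) ℝ) (U : Matrix (Fin n) (Fin r) ℝ)
    (R : Matrix (Fin r) (Fin r) ℝ) : Prop :=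
  R.PosDef ∧ lowRankRiccati Ad Gd C H U R = R

/-- The closed-loop matrix `A_d (I - U F C)` of the low-rank filter. -/
def closedLoop {n p r : ℕ} (Ad : Matrix (Fin n) (Fin n) ℝ) (C : Matrix (Fin p) (Fin n) ℝ)
    (U : Matrix (Fin n) (Fin r) ℝ) (F : Matrix (Fin r) (Fin p) ℝ) : Matrix (Fin n) (Fin n) ℝ :=
  Ad * (1 - U * F * C)

end LowRankKalman

end

set_option linter.unusedSectionVars false

/-! At an equilibrium of the Oja flow the column space of `U` is invariant under `A`, hence under
`discA A h`. In an orthonormal basis adapted to `U` and a complement `V`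
(`exists_orthonormal_completion`), both `A` and the closed loop are block upper triangular, and
`eigenvalues_eq_add` splits their spectra. The closed-loop block on the column space is that of an
ordinary `r`-dimensional Kalman filter. The block on the complement is `discA (Vᵀ * A * V) h`, which
the gain cannot influence.

The first block is always Schur stable. Reachability makes the sampled noise covariance positive
definite (`noiseCov_posDef`), so the reduced process noise is too, and observability passes to the
invariant subspace. Completing the square expresses the Riccati map as a minimum over controls. This
yields existence (a monotone bounded iteration from zero), uniqueness, and a strict Lyapunov
inequality: see `existsUnique_riccati` and `norm_lt_one_of_riccati`.

It remains to decide when `Vᵀ * A * V` is Hurwitz. Suppose it had an eigenvalue `μ` strictly to the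
right of an eigenvalue `ν` of `Uᵀ * A * U`. Perturbing `U` by the real part of `v wᵀ`, with `v` a
generalized eigenvector for `μ` and `w` a left eigenvector for `ν`, gives a column space that the
backward linear flow carries to that of `U`. Orbits starting arbitrarily near `U` would then reach
this fixed other column space, against stability (`mul_transpose_mul_eq_of_tendsto`,
`re_le_re_of_mem_stable`). So the spectrum on the column space dominates, the gap makes it exactly
the `r` rightmost eigenvalues, and the others are all stable iff at most `r` eigenvalues are
unstable (`forall_re_neg_iff`). -/

namespace LowRankKalman

/-! ### The algebraic Riccati equation as a minimization problem. -/

section Riccati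

variable {n p m : Type*} [Fintype n] [DecidableEq n] [Fintype p] [DecidableEq p]

/-- The right-hand side of the discrete algebraic Riccati equation. -/
noncomputable def riccati (A : Matrix n n ℝ) (C : Matrix p n ℝ) (M : Matrix p p ℝ)
    (Q R : Matrix n n ℝ) : Matrix n n ℝ :=
  A * (1 - R * Cᵀ * (C * R * Cᵀ + M)⁻¹ * C) * R * Aᵀ + Q

/-- The optimal (predictor) gain belonging to `R`. -/
noncomputable def optGain (A : Matrix n n ℝ) (C : Matrix p n ℝ) (M : Matrix p p ℝ)
    (R : Matrix n n ℝ) : Matrix n p ℝ :=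
  A * (R * Cᵀ * (C * R * Cᵀ + M)⁻¹)

/-- The quadratic form of a real matrix. -/
def quad (R : Matrix n n ℝ) (x : n → ℝ) : ℝ := x ⬝ᵥ (R *ᵥ x)

variable {A : Matrix n n ℝ} {C : Matrix p n ℝ} {M : Matrix p p ℝ} {Q R : Matrix n n ℝ}

lemma posDef_innovation (hM : M.PosDef) (hR : R.PosSemidef) : (C * R * Cᵀ + M).PosDef := by
  have := hR.mul_mul_conjTranspose_same C
  rw [Matrix.conjTranspose_eq_transpose_of_trivial] at this
  exact hM.posSemidef_add this

lemma transpose_of_posSemidef {k : Type*} {R : Matrix k k ℝ} (hR : R.PosSemidef) : Rᵀ = R := by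
  simpa [Matrix.conjTranspose_eq_transpose_of_trivial] using hR.isHermitian.eq

/-- Completion of the square in the Riccati equation. -/
lemma riccati_complete_square (hM : M.PosDef) (hR : R.PosSemidef)
    (X : Matrix m n ℝ) (K : Matrix m p ℝ) :
    (X * A - K * C) * R * (X * A - K * C)ᵀ + K * M * Kᵀ + X * Q * Xᵀ =
      X * riccati A C M Q R * Xᵀ +
        (K - X * optGain A C M R) * (C * R * Cᵀ + M) * (K - X * optGain A C M R)ᵀ := by
  have hN := posDef_innovation (C := C) hM hR
  have hRt := transpose_of_posSemidef hR
  have hNt := transpose_of_posSemidef hN.posSemidef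
  have hdet : IsUnit (C * R * Cᵀ + M).det := hN.det_pos.ne'.isUnit
  set N := C * R * Cᵀ + M with hNdef
  have h1 : N * (optGain A C M R)ᵀ = C * R * Aᵀ := by
    simp only [optGain, ← hNdef, Matrix.transpose_mul, Matrix.transpose_nonsing_inv, hNt, hRt,
      Matrix.transpose_transpose]
    simp only [← Matrix.mul_assoc, Matrix.mul_nonsing_inv _ hdet, Matrix.one_mul]
  have h2 : optGain A C M R * N = A * R * Cᵀ := by
    have := congrArg Matrix.transpose h1
    simpa only [Matrix.transpose_mul, Matrix.transpose_transpose, hNt, hRt,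
      ← Matrix.mul_assoc] using this
  have h3 : riccati A C M Q R = A * R * Aᵀ - optGain A C M R * (C * R * Aᵀ) + Q := by
    simp only [riccati, optGain, Matrix.mul_sub, Matrix.sub_mul, Matrix.mul_one,
      Matrix.mul_assoc]
  -- Once `M` is eliminated, both sides are noncommutative polynomials whose monomials match.
  have hM' : M = N - C * R * Cᵀ := by rw [hNdef]; abel
  have e1 : (K - X * optGain A C M R) * N * (K - X * optGain A C M R)ᵀ
      = K * N * Kᵀ - K * (C * R * Aᵀ) * Xᵀ - X * (A * R * Cᵀ) * Kᵀ
        + X * (optGain A C M R * (C * R * Aᵀ)) * Xᵀ := by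
    rw [← h1, ← h2]
    simp only [Matrix.transpose_sub, Matrix.transpose_mul, Matrix.sub_mul, Matrix.mul_sub,
      Matrix.mul_assoc]
    abel
  rw [e1, h3, hM']
  simp only [Matrix.transpose_sub, Matrix.transpose_mul, Matrix.sub_mul, Matrix.mul_sub,
      Matrix.mul_assoc, Matrix.mul_add, Matrix.add_mul]
  abel

/-- Viewing a vector as a one-row matrix makes the scalar completion of the square the 1×1 case of
the matrix one. -/
lemma quad_eq (R : Matrix n n ℝ) (x : n → ℝ) :
    quad R x = (Matrix.replicateRow Unit x * R * (Matrix.replicateRow Unit x)ᵀ) () () := by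
  rw [quad, Matrix.mul_assoc, Matrix.mul_apply]
  simp [dotProduct, Matrix.mul_apply, Matrix.mulVec]

lemma replicateRow_sub (x y : n → ℝ) : Matrix.replicateRow Unit (x - y) =
    Matrix.replicateRow Unit x - Matrix.replicateRow Unit y := rfl

lemma quad_complete_square (hM : M.PosDef) (hR : R.PosSemidef) (x : n → ℝ) (u : p → ℝ) :
    quad R (x ᵥ* A - u ᵥ* C) + quad M u + quad Q x =
      quad (riccati A C M Q R) x + quad (C * R * Cᵀ + M) (u - x ᵥ* optGain A C M R) := by
  have := congrFun (congrFun (riccati_complete_square (A := A) (C := C) (Q := Q) hM hR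
    (Matrix.replicateRow Unit x) (Matrix.replicateRow Unit u)) ()) ()
  simp only [Matrix.add_apply] at this
  simpa only [quad_eq, Matrix.replicateRow_vecMul, replicateRow_sub] using this

lemma quad_nonneg (hR : R.PosSemidef) (x : n → ℝ) : 0 ≤ quad R x := by
  simpa [quad] using hR.dotProduct_mulVec_nonneg x

lemma quad_pos (hR : R.PosDef) {x : n → ℝ} (hx : x ≠ 0) : 0 < quad R x := by
  simpa [quad] using hR.dotProduct_mulVec_pos hx

/-- The completed square is nonnegative and is dropped: every control `u` gives an upper bound,
which is the Bellman inequality of the dual control problem. -/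
lemma quad_riccati_le (hM : M.PosDef) (hR : R.PosSemidef) (x : n → ℝ) (u : p → ℝ) :
    quad (riccati A C M Q R) x ≤ quad R (x ᵥ* A - u ᵥ* C) + quad M u + quad Q x := by
  rw [quad_complete_square hM hR]
  linarith [quad_nonneg (posDef_innovation (C := C) hM hR).posSemidef (u - x ᵥ* optGain A C M R)]

/-- The Bellman bound is attained at the optimal control, where the completed square vanishes. -/
lemma quad_riccati_eq (hM : M.PosDef) (hR : R.PosSemidef) (x : n → ℝ) :
    quad (riccati A C M Q R) x = quad R (x ᵥ* (A - optGain A C M R * C))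
      + quad M (x ᵥ* optGain A C M R) + quad Q x := by
  have := quad_complete_square (A := A) (C := C) (Q := Q) hM hR x (x ᵥ* optGain A C M R)
  rw [sub_self] at this
  simp only [quad, Matrix.mulVec_zero, dotProduct_zero, add_zero] at this ⊢
  rw [← this, Matrix.vecMul_sub, Matrix.vecMul_vecMul]

lemma riccati_posSemidef (hM : M.PosDef) (hQ : Q.PosSemidef) (hR : R.PosSemidef) :
    (riccati A C M Q R).PosSemidef := by
  have := riccati_complete_square (A := A) (C := C) (Q := Q) hM hR 1 (optGain A C M R)
  simp only [Matrix.one_mul, sub_self, Matrix.zero_mul, Matrix.transpose_one, Matrix.mul_one,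
    add_zero] at this
  rw [← this]
  have h1 := hR.mul_mul_conjTranspose_same (A - optGain A C M R * C)
  have h2 := hM.posSemidef.mul_mul_conjTranspose_same (optGain A C M R)
  simp only [Matrix.conjTranspose_eq_transpose_of_trivial] at h1 h2
  exact (h1.add h2).add hQ

/-- The control that is optimal for `R'` is merely admissible for `R`, which has the smaller cost.
-/
lemma quad_riccati_mono {R' : Matrix n n ℝ} (hM : M.PosDef) (hR : R.PosSemidef)
    (hR' : R'.PosSemidef) (h : ∀ x, quad R x ≤ quad R' x) (x : n → ℝ) :
    quad (riccati A C M Q R) x ≤ quad (riccati A C M Q R') x := by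
  rw [quad_riccati_eq hM hR' x]
  refine (quad_riccati_le hM hR x (x ᵥ* optGain A C M R')).trans ?_
  have := h (x ᵥ* (A - optGain A C M R' * C))
  rw [Matrix.vecMul_sub, ← Matrix.vecMul_vecMul] at this ⊢
  linarith

/-- The Riccati iteration started at zero. -/
noncomputable def riccatiSeq (A : Matrix n n ℝ) (C : Matrix p n ℝ) (M : Matrix p p ℝ)
    (Q : Matrix n n ℝ) (k : ℕ) : Matrix n n ℝ :=
  (riccati A C M Q)^[k] 0

lemma riccatiSeq_succ (k : ℕ) :
    riccatiSeq A C M Q (k + 1) = riccati A C M Q (riccatiSeq A C M Q k) :=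
  Function.iterate_succ_apply' _ _ _

lemma riccatiSeq_posSemidef (hM : M.PosDef) (hQ : Q.PosSemidef) (k : ℕ) :
    (riccatiSeq A C M Q k).PosSemidef := by
  induction k with
  | zero => exact Matrix.PosSemidef.zero
  | succ k ih => rw [riccatiSeq_succ]; exact riccati_posSemidef hM hQ ih

lemma quad_riccatiSeq_mono (hM : M.PosDef) (hQ : Q.PosSemidef) (x : n → ℝ) :
    Monotone fun k => quad (riccatiSeq A C M Q k) x := by
  refine monotone_nat_of_le_succ fun k => ?_
  induction k generalizing x with
  | zero =>
    have := quad_nonneg (riccatiSeq_posSemidef (A := A) (C := C) hM hQ 1) x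
    simpa [riccatiSeq, quad] using this
  | succ k ih =>
    simp only [riccatiSeq_succ] at ih ⊢
    exact quad_riccati_mono hM (riccatiSeq_posSemidef hM hQ k)
      (riccati_posSemidef hM hQ (riccatiSeq_posSemidef hM hQ k)) ih x

lemma bddAbove_quad_riccatiSeq_step (hM : M.PosDef) (hQ : Q.PosSemidef) (x : n → ℝ) (u : p → ℝ)
    (h : BddAbove (Set.range fun k => quad (riccatiSeq A C M Q k) (x ᵥ* A - u ᵥ* C))) :
    BddAbove (Set.range fun k => quad (riccatiSeq A C M Q k) x) := by
  obtain ⟨b, hb⟩ := h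
  refine ⟨b + quad M u + quad Q x, ?_⟩
  rintro _ ⟨k, rfl⟩
  refine (quad_riccatiSeq_mono hM hQ x (Nat.le_succ k)).trans ?_
  simp only [riccatiSeq_succ]
  refine (quad_riccati_le hM (riccatiSeq_posSemidef hM hQ k) x u).trans ?_
  have := hb ⟨k, rfl⟩
  simp only at this
  linarith

/-- If some controls steer `x` to zero then the Riccati iteration is bounded along `x`. -/
lemma bddAbove_quad_riccatiSeq (hM : M.PosDef) (hQ : Q.PosSemidef) (N : ℕ) (u : ℕ → p → ℝ)
    (x : n → ℝ) (h : x ᵥ* A ^ N = ∑ k ∈ Finset.range N, u k ᵥ* (C * A ^ k)) :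
    BddAbove (Set.range fun k => quad (riccatiSeq A C M Q k) x) := by
  induction N generalizing x with
  | zero =>
    have : x = 0 := by simpa using h
    subst this
    exact ⟨0, by rintro _ ⟨k, rfl⟩; simp [quad]⟩
  | succ N ih =>
    refine bddAbove_quad_riccatiSeq_step hM hQ x (u N) (ih _ ?_)
    rw [Finset.sum_range_succ, pow_succ', ← Matrix.vecMul_vecMul] at h
    rw [Matrix.sub_vecMul, h, Matrix.vecMul_vecMul]
    abel

/-- Polarization, so that entrywise limits can be read off from limits of quadratic forms. -/
lemma apply_eq_quad {R : Matrix n n ℝ} (hR : Rᵀ = R) (i j : n) :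
    R i j = (quad R (Pi.single i 1 + Pi.single j 1) - quad R (Pi.single i 1)
      - quad R (Pi.single j 1)) / 2 := by
  have h : R j i = R i j := congrFun (congrFun hR i) j
  simp only [quad, Matrix.mulVec_add, add_dotProduct, dotProduct_add, Matrix.mulVec_single_one,
    single_one_dotProduct, Matrix.col_apply]
  linarith

lemma ext_quad {R R' : Matrix n n ℝ} (hR : Rᵀ = R) (hR' : R'ᵀ = R')
    (h : ∀ x, quad R x = quad R' x) : R = R' := by
  ext i j
  rw [apply_eq_quad hR, apply_eq_quad hR', h, h, h]

lemma continuous_quad (x : n → ℝ) : Continuous fun R : Matrix n n ℝ => quad R x := by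
  unfold quad; fun_prop

lemma tendsto_riccati {ι : Type*} {l : Filter ι} {f : ι → Matrix n n ℝ} (hM : M.PosDef)
    (hR : R.PosSemidef) (hf : Filter.Tendsto f l (𝓝 R)) :
    Filter.Tendsto (fun i => riccati A C M Q (f i)) l (𝓝 (riccati A C M Q R)) := by
  have hdet := (posDef_innovation (C := C) hM hR).det_pos.ne'
  have hc : ContinuousAt (fun R : Matrix n n ℝ => riccati A C M Q R) R := by
    unfold riccati
    simp only [Matrix.inv_def, Ring.inverse_eq_inv']
    have h1 : ContinuousAt (fun R : Matrix n n ℝ => ((C * R * Cᵀ + M).det)⁻¹) R :=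
      ContinuousAt.inv₀ (by fun_prop) hdet
    have h2 : ContinuousAt (fun R : Matrix n n ℝ => (C * R * Cᵀ + M).adjugate) R := by
      have : Continuous (fun R : Matrix n n ℝ => (C * R * Cᵀ + M).adjugate) :=
        Continuous.matrix_adjugate (by fun_prop)
      exact this.continuousAt
    fun_prop
  exact hc.tendsto.comp hf

/-- Existence of a solution of the Riccati equation. -/
lemma exists_riccati_eq (hM : M.PosDef) (hQ : Q.PosSemidef)
    (hb : ∀ x, BddAbove (Set.range fun k => quad (riccatiSeq A C M Q k) x)) :
    ∃ R : Matrix n n ℝ, R.PosSemidef ∧ riccati A C M Q R = R := by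
  have hlim : ∀ x, ∃ l, Filter.Tendsto (fun k => quad (riccatiSeq A C M Q k) x) Filter.atTop
      (𝓝 l) := fun x => ⟨_, tendsto_atTop_ciSup (quad_riccatiSeq_mono hM hQ x) (hb x)⟩
  choose L hL using hlim
  have hps := riccatiSeq_posSemidef (A := A) (C := C) hM hQ
  -- The limit matrix is rebuilt by polarization from the monotone limits of the quadratic forms.
  let R : Matrix n n ℝ := Matrix.of fun i j =>
    (L (Pi.single i 1 + Pi.single j 1) - L (Pi.single i 1) - L (Pi.single j 1)) / 2
  have hR : Filter.Tendsto (riccatiSeq A C M Q) Filter.atTop (𝓝 R) := by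
    refine tendsto_pi_nhds.2 fun i => tendsto_pi_nhds.2 fun j => ?_
    simp only [apply_eq_quad (transpose_of_posSemidef (hps _)) i j]
    exact (((hL _).sub (hL _)).sub (hL _)).div_const 2
  have hRt : Rᵀ = R := by
    ext i j
    simp only [R, Matrix.transpose_apply, Matrix.of_apply]
    rw [add_comm (Pi.single j (1 : ℝ) : n → ℝ)]
    ring
  have hRps : R.PosSemidef := by
    refine Matrix.PosSemidef.of_dotProduct_mulVec_nonneg ?_ fun x => ?_
    · rw [Matrix.IsHermitian, Matrix.conjTranspose_eq_transpose_of_trivial, hRt]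
    · have h1 := ((continuous_quad x).tendsto R).comp hR
      simpa [quad] using ge_of_tendsto' h1 fun k => quad_nonneg (hps k) x
  refine ⟨R, hRps, ?_⟩
  have h1 := tendsto_riccati (A := A) (C := C) (Q := Q) hM hRps hR
  have h2 := hR.comp (Filter.tendsto_add_atTop_nat 1)
  refine tendsto_nhds_unique h1 (h2.congr fun k => ?_)
  simp [riccatiSeq_succ]

/-- A fixed point is a Lyapunov function for its own closed loop, decreasing by at least the process
noise form. -/
lemma quad_closedLoop_le (hM : M.PosDef) (hR : R.PosSemidef) (hfix : riccati A C M Q R = R)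
    (x : n → ℝ) : quad R (x ᵥ* (A - optGain A C M R * C)) ≤ quad R x - quad Q x := by
  have h := quad_riccati_eq (A := A) (C := C) (Q := Q) hM hR x
  rw [hfix] at h
  linarith [quad_nonneg hM.posSemidef (x ᵥ* optGain A C M R)]

/-- Solutions of the closed-loop recursion decay along the process noise form. -/
lemma tendsto_quad_closedLoop (hM : M.PosDef) (hQ : Q.PosSemidef) (hR : R.PosSemidef)
    (hfix : riccati A C M Q R = R) (x : n → ℝ) :
    Filter.Tendsto (fun k : ℕ => quad Q (x ᵥ* (A - optGain A C M R * C) ^ k)) Filter.atTop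
      (𝓝 0) := by
  set B := A - optGain A C M R * C with hB
  -- The Lyapunov decrease telescopes, so the noise terms are summable and tend to zero.
  have hs : ∀ k, ∑ i ∈ Finset.range k, quad Q (x ᵥ* B ^ i) ≤ quad R x - quad R (x ᵥ* B ^ k) := by
    intro k
    induction k with
    | zero => simp
    | succ k ih =>
      have := quad_closedLoop_le hM hR hfix (x ᵥ* B ^ k)
      rw [← hB, Matrix.vecMul_vecMul, ← pow_succ] at this
      rw [Finset.sum_range_succ]
      linarith
  refine (summable_of_sum_range_le (c := quad R x) (fun k => quad_nonneg hQ _)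
    fun k => ?_).tendsto_atTop_zero
  linarith [hs k, quad_nonneg hR (x ᵥ* B ^ k)]

open scoped MatrixOrder in
lemma exists_eq_transpose_mul_self (hR : R.PosSemidef) : ∃ B : Matrix n n ℝ, R = Bᵀ * B := by
  obtain ⟨B, hB⟩ := CStarAlgebra.nonneg_iff_eq_star_mul_self.mp hR.nonneg
  exact ⟨B, by rw [hB, Matrix.star_eq_conjTranspose,
    Matrix.conjTranspose_eq_transpose_of_trivial]⟩

/-- With `Q = Bᵀ * B` and `B` invertible, the form is the squared length of `B *ᵥ f`, and `B⁻¹`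
recovers `f`. -/
lemma tendsto_zero_of_tendsto_quad {ι : Type*} {l : Filter ι} {f : ι → n → ℝ} (hQ : Q.PosDef)
    (hf : Filter.Tendsto (fun i => quad Q (f i)) l (𝓝 0)) : Filter.Tendsto f l (𝓝 0) := by
  obtain ⟨B, rfl⟩ := exists_eq_transpose_mul_self hQ.posSemidef
  have hdet : IsUnit B.det := by
    have := hQ.det_pos.ne'
    rw [Matrix.det_mul] at this
    exact (right_ne_zero_of_mul this).isUnit
  have hq : ∀ x, quad (Bᵀ * B) x = ∑ i, (B *ᵥ x) i * (B *ᵥ x) i := by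
    intro x
    rw [quad, ← Matrix.mulVec_mulVec,
      Matrix.dotProduct_mulVec, Matrix.vecMul_transpose]
    rfl
  have h1 : Filter.Tendsto (fun i => B *ᵥ f i) l (𝓝 0) := by
    refine tendsto_pi_nhds.2 fun j => ?_
    have h2 : Filter.Tendsto (fun i => (B *ᵥ f i) j * (B *ᵥ f i) j) l (𝓝 0) := by
      refine squeeze_zero (fun i => mul_self_nonneg _) (fun i => ?_) hf
      rw [hq]
      exact Finset.single_le_sum (f := fun j => (B *ᵥ f i) j * (B *ᵥ f i) j)
        (fun k _ => mul_self_nonneg _) (Finset.mem_univ j)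
    have h3 := h2.sqrt
    simp only [Real.sqrt_mul_self_eq_abs, Real.sqrt_zero] at h3
    exact (tendsto_zero_iff_abs_tendsto_zero _).2 h3
  have hc : Continuous fun y : n → ℝ => B⁻¹ *ᵥ y := by fun_prop
  have h4 := (hc.tendsto 0).comp h1
  simpa [Function.comp_def, Matrix.mulVec_mulVec, Matrix.nonsing_inv_mul _ hdet] using h4

/-- Using the gain of `R'` for both matrices, the running costs cancel, and the difference of the
forms at `x` is at most the difference one closed-loop step later. Along the closed loop of `R'` the
state tends to zero, so the difference at `x` is nonpositive. -/
lemma riccati_solution_le {R' : Matrix n n ℝ} (hM : M.PosDef) (hQ : Q.PosDef)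
    (hR : R.PosSemidef) (hR' : R'.PosSemidef) (hfix : riccati A C M Q R = R)
    (hfix' : riccati A C M Q R' = R') (x : n → ℝ) : quad R x ≤ quad R' x := by
  set B := A - optGain A C M R' * C with hB
  have step : ∀ x, quad R x - quad R' x ≤ quad R (x ᵥ* B) - quad R' (x ᵥ* B) := by
    intro x
    have h1 := quad_riccati_le (A := A) (C := C) (Q := Q) hM hR x (x ᵥ* optGain A C M R')
    have h2 := quad_riccati_eq (A := A) (C := C) (Q := Q) hM hR' x
    rw [Matrix.vecMul_vecMul, ← Matrix.vecMul_sub, ← hB, hfix] at h1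
    rw [← hB, hfix'] at h2
    linarith
  have hk : ∀ k : ℕ, quad R x - quad R' x ≤ quad R (x ᵥ* B ^ k) - quad R' (x ᵥ* B ^ k) := by
    intro k
    induction k with
    | zero => simp
    | succ k ih =>
      refine ih.trans ((step _).trans_eq ?_)
      rw [Matrix.vecMul_vecMul, ← pow_succ]
  have h0 : Filter.Tendsto (fun k : ℕ => x ᵥ* B ^ k) Filter.atTop (𝓝 0) :=
    tendsto_zero_of_tendsto_quad hQ (tendsto_quad_closedLoop hM hQ.posSemidef hR' hfix' x)
  have hc : Continuous fun y : n → ℝ => quad R y - quad R' y := by unfold quad; fun_prop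
  have h1 := ge_of_tendsto' ((hc.tendsto 0).comp h0) hk
  simp only [quad, zero_dotProduct, sub_self] at h1
  simpa [quad] using h1

/-- Uniqueness of the positive semidefinite solution of the Riccati equation. -/
lemma riccati_unique {R' : Matrix n n ℝ} (hM : M.PosDef) (hQ : Q.PosDef) (hR : R.PosSemidef)
    (hR' : R'.PosSemidef) (hfix : riccati A C M Q R = R) (hfix' : riccati A C M Q R' = R') :
    R = R' :=
  ext_quad (transpose_of_posSemidef hR) (transpose_of_posSemidef hR') fun x =>
    le_antisymm (riccati_solution_le hM hQ hR hR' hfix hfix' x)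
      (riccati_solution_le hM hQ hR' hR hfix' hfix x)

lemma riccati_posDef (hM : M.PosDef) (hQ : Q.PosDef) (hR : R.PosSemidef) :
    (riccati A C M Q R).PosDef := by
  refine Matrix.PosDef.of_dotProduct_mulVec_pos
    (riccati_posSemidef hM hQ.posSemidef hR).isHermitian fun x hx => ?_
  have h := quad_riccati_eq (A := A) (C := C) (Q := Q) hM hR x
  have := quad_pos hQ hx
  have h1 := quad_nonneg hR (x ᵥ* (A - optGain A C M R * C))
  have h2 := quad_nonneg hM.posSemidef (x ᵥ* optGain A C M R)
  simp only [quad, star_trivial] at *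
  linarith

end Riccati

/-- A matrix satisfying a strict Lyapunov inequality has its spectrum in the open unit disc. -/
lemma norm_lt_one_of_lyapunov {n : Type*} [Fintype n] [DecidableEq n] {B R : Matrix n n ℝ}
    (hR : R.PosSemidef) (h : ∀ x ≠ 0, quad R (x ᵥ* B) < quad R x) {z : ℂ}
    {w : n → ℂ} (hw : w ≠ 0) (hz : w ᵥ* B.map (algebraMap ℝ ℂ) = z • w) : ‖z‖ < 1 := by
  set a : n → ℝ := fun i => (w i).re with ha
  set b : n → ℝ := fun i => (w i).im with hb
  have h1 : a ᵥ* B = z.re • a - z.im • b := by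
    ext i
    have := congrArg Complex.re (congrFun hz i)
    simpa [Matrix.vecMul, dotProduct, ha, hb] using this
  have h2 : b ᵥ* B = z.im • a + z.re • b := by
    ext i
    have := congrArg Complex.im (congrFun hz i)
    simpa [Matrix.vecMul, dotProduct, ha, hb, add_comm] using this
  -- The cross terms of the real and imaginary parts cancel: this is the Hermitian form of `R` at
  -- `w`.
  have h3 : quad R (a ᵥ* B) + quad R (b ᵥ* B) = ‖z‖ ^ 2 * (quad R a + quad R b) := by
    rw [h1, h2, ← Complex.normSq_eq_norm_sq, Complex.normSq_apply]
    simp only [quad, Matrix.mulVec_add, Matrix.mulVec_sub, Matrix.mulVec_smul, dotProduct_add,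
      add_dotProduct, dotProduct_sub, sub_dotProduct, smul_dotProduct, dotProduct_smul,
      smul_eq_mul]
    ring
  have hab : a ≠ 0 ∨ b ≠ 0 := by
    by_contra! hc
    exact hw (funext fun i => Complex.ext (congrFun hc.1 i) (congrFun hc.2 i))
  have hle : ∀ x, quad R (x ᵥ* B) ≤ quad R x := by
    intro x
    rcases eq_or_ne x 0 with rfl | hx
    · simp [quad]
    · exact (h x hx).le
  have h4 : ‖z‖ ^ 2 * (quad R a + quad R b) < quad R a + quad R b := by
    rw [← h3]
    rcases hab with h' | h'
    · linarith [h a h', hle b]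
    · linarith [h b h', hle a]
  have h5 : 0 ≤ quad R a + quad R b := add_nonneg (quad_nonneg hR a) (quad_nonneg hR b)
  by_contra! hc
  nlinarith [one_le_pow₀ hc (n := 2)]

/-- The closed loop of the stationary filter is Schur stable. -/
lemma norm_lt_one_of_riccati {n p : Type*} [Fintype n] [DecidableEq n] [Fintype p]
    [DecidableEq p] {A : Matrix n n ℝ} {C : Matrix p n ℝ} {M : Matrix p p ℝ} {Q R : Matrix n n ℝ}
    (hM : M.PosDef) (hQ : Q.PosDef) (hR : R.PosSemidef) (hfix : riccati A C M Q R = R) {z : ℂ}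
    {w : n → ℂ} (hw : w ≠ 0)
    (hz : w ᵥ* (A - optGain A C M R * C).map (algebraMap ℝ ℂ) = z • w) : ‖z‖ < 1 :=
  norm_lt_one_of_lyapunov hR (fun x hx => by
    linarith [quad_closedLoop_le hM hR hfix x, quad_pos hQ hx]) hw hz

/-- Existence and uniqueness of the stationary covariance. -/
lemma existsUnique_riccati {n p : Type*} [Fintype n] [DecidableEq n] [Fintype p]
    [DecidableEq p] {A : Matrix n n ℝ} {C : Matrix p n ℝ} {M : Matrix p p ℝ} {Q : Matrix n n ℝ}
    (hM : M.PosDef) (hQ : Q.PosDef) (N : ℕ)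
    (hobs : ∀ y : n → ℝ, ∃ u : ℕ → p → ℝ, y = ∑ k ∈ Finset.range N, u k ᵥ* (C * A ^ k)) :
    ∃! R : Matrix n n ℝ, R.PosDef ∧ riccati A C M Q R = R := by
  obtain ⟨R, hR, hfix⟩ := exists_riccati_eq (A := A) (C := C) hM hQ.posSemidef fun x => by
    -- Observability is controllability of the dual system: some controls steer `x` to zero in `N`
    -- steps.
    obtain ⟨u, hu⟩ := hobs (x ᵥ* A ^ N)
    exact bddAbove_quad_riccatiSeq hM hQ.posSemidef N u x hu
  refine ⟨R, ⟨hfix ▸ riccati_posDef hM hQ hR, hfix⟩, fun R' hR' => ?_⟩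
  exact riccati_unique hM hQ hR'.1.posSemidef hR hR'.2 hfix

/-! ### Block triangular spectra and counting of eigenvalues. -/

section Spectrum

/-- A matrix with orthonormal columns can be completed to an orthogonal matrix. -/
lemma exists_orthonormal_completion {n r : ℕ} (hrn : r ≤ n) {U : Matrix (Fin n) (Fin r) ℝ}
    (hU : Uᵀ * U = 1) : ∃ V : Matrix (Fin n) (Fin (n - r)) ℝ,
      Uᵀ * V = 0 ∧ Vᵀ * V = 1 ∧ U * Uᵀ + V * Vᵀ = 1 := by
  -- Only the left summand is prescribed; the zeros on the right are placeholders that the extension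
  -- replaces.
  let v : Fin r ⊕ Fin (n - r) → EuclideanSpace ℝ (Fin n) :=
    Sum.elim (fun j => WithLp.toLp 2 fun i => U i j) 0
  have hv : Orthonormal ℝ ((Set.range Sum.inl).domRestrict v) := by
    rw [orthonormal_iff_ite]
    rintro ⟨_, i, rfl⟩ ⟨_, j, rfl⟩
    have h := congrFun (congrFun hU i) j
    rw [Matrix.mul_apply, Matrix.one_apply] at h
    simp only [Set.domRestrict_apply, v, Sum.elim_inl, PiLp.inner_apply]
    by_cases hij : i = j
    · subst hij
      simpa [← sq] using h
    · have hne : (⟨Sum.inl i, i, rfl⟩ : Set.range (Sum.inl : _ → Fin r ⊕ Fin (n - r))) ≠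
          ⟨Sum.inl j, j, rfl⟩ := fun h => hij (Sum.inl_injective (congrArg Subtype.val h))
      rw [if_neg hij] at h
      rw [if_neg hne]
      simpa [mul_comm] using h
  obtain ⟨b, hb⟩ := hv.exists_orthonormalBasis_extension_of_card_eq
    (by simp [Nat.add_sub_cancel' hrn])
  have hbU : ∀ i j, b (Sum.inl j) i = U i j := fun i j => by rw [hb _ ⟨j, rfl⟩]; rfl
  refine ⟨Matrix.of fun i j => b (Sum.inr j) i, ?_, ?_, ?_⟩
  · ext i j
    have := b.inner_eq_ite (Sum.inl i) (Sum.inr j)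
    rw [PiLp.inner_apply] at this
    simpa [PiLp.inner_apply, Matrix.mul_apply, hbU, mul_comm] using this
  · ext i j
    have := b.inner_eq_ite (Sum.inr i) (Sum.inr j)
    simpa [PiLp.inner_apply, Matrix.mul_apply, Matrix.one_apply, mul_comm] using this
  · ext i j
    have := b.sum_inner_mul_inner (EuclideanSpace.single i 1) (EuclideanSpace.single j 1)
    simp only [Fintype.sum_sum_type, EuclideanSpace.inner_single_left,
      EuclideanSpace.inner_single_right, hbU] at this
    simpa [Matrix.mul_apply, Matrix.one_apply, eq_comm] using this

/-- The spectrum of a block triangular matrix. -/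
lemma eigenvalues_eq_add {n r : ℕ} (hrn : r ≤ n) {U : Matrix (Fin n) (Fin r) ℝ}
    {V : Matrix (Fin n) (Fin (n - r)) ℝ} (hsum : U * Uᵀ + V * Vᵀ = 1) {K : Matrix (Fin n) (Fin n) ℝ} (hK : Vᵀ * K * U = 0) :
    eigenvalues K = eigenvalues (Uᵀ * K * U) + eigenvalues (Vᵀ * K * V) := by
  let T : Matrix (Fin n) (Fin r ⊕ Fin (n - r)) ℝ := Matrix.fromCols U V
  have hT : T * Tᵀ = 1 := by
    rw [Matrix.transpose_fromCols, Matrix.fromCols_mul_fromRows, hsum]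
  have hblock : Tᵀ * (K * T) =
      Matrix.fromBlocks (Uᵀ * K * U) (Uᵀ * K * V) 0 (Vᵀ * K * V) := by
    rw [Matrix.transpose_fromCols, Matrix.mul_fromCols, Matrix.fromRows_mul_fromCols]
    simp only [← Matrix.mul_assoc, hK]
  -- `T` is orthogonal but its index types differ, so the two products are compared through their
  -- characteristic polynomials, with equal powers of `X` cancelled afterwards.
  have h1 := Matrix.charpoly_mul_comm' (K * T) Tᵀ
  rw [Matrix.mul_assoc, hT, Matrix.mul_one, hblock, Matrix.charpoly_fromBlocks_zero₂₁] at h1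
  have hcard : Fintype.card (Fin r ⊕ Fin (n - r)) = Fintype.card (Fin n) := by
    simp [Nat.add_sub_cancel' hrn]
  rw [hcard] at h1
  have h2 : K.charpoly = (Uᵀ * K * U).charpoly * (Vᵀ * K * V).charpoly :=
    (Polynomial.isRegular_X_pow _).left.eq_iff.mp h1
  simp only [eigenvalues, Matrix.charpoly_map]
  rw [h2, Polynomial.map_mul, Polynomial.roots_mul]
  exact mul_ne_zero ((Matrix.charpoly_monic _).map _).ne_zero
    ((Matrix.charpoly_monic _).map _).ne_zero

lemma card_eigenvalues {n : ℕ} (A : Matrix (Fin n) (Fin n) ℝ) : (eigenvalues A).card = n := by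
  rw [eigenvalues, IsAlgClosed.card_roots_eq_natDegree, Matrix.charpoly_natDegree_eq_dim,
    Fintype.card_fin]

lemma mem_eigenvalues_iff {n : ℕ} {A : Matrix (Fin n) (Fin n) ℝ} {z : ℂ} :
    z ∈ eigenvalues A ↔ (Matrix.scalar (Fin n) z - A.map (algebraMap ℝ ℂ)).det = 0 := by
  rw [eigenvalues, Polynomial.mem_roots (Matrix.charpoly_monic _).ne_zero, Polynomial.IsRoot,
    Matrix.eval_charpoly]

lemma mem_eigenvalues_iff_mulVec {n : ℕ} {A : Matrix (Fin n) (Fin n) ℝ} {z : ℂ} :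
    z ∈ eigenvalues A ↔ ∃ v ≠ 0, A.map (algebraMap ℝ ℂ) *ᵥ v = z • v := by
  rw [mem_eigenvalues_iff, ← Matrix.exists_mulVec_eq_zero_iff]
  refine exists_congr fun v => and_congr_right fun _ => ?_
  rw [Matrix.sub_mulVec, sub_eq_zero, eq_comm, Matrix.scalar_apply, ← Matrix.smul_one_eq_diagonal,
    Matrix.smul_mulVec, Matrix.one_mulVec]

lemma mem_eigenvalues_iff_vecMul {n : ℕ} {A : Matrix (Fin n) (Fin n) ℝ} {z : ℂ} :
    z ∈ eigenvalues A ↔ ∃ v ≠ 0, v ᵥ* A.map (algebraMap ℝ ℂ) = z • v := by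
  rw [mem_eigenvalues_iff, ← Matrix.exists_vecMul_eq_zero_iff]
  refine exists_congr fun v => and_congr_right fun _ => ?_
  rw [Matrix.vecMul_sub, sub_eq_zero, eq_comm, Matrix.scalar_apply, ← Matrix.smul_one_eq_diagonal,
    Matrix.vecMul_smul, Matrix.vecMul_one]

/-- A gap in a decreasingly ordered list separates the entries before it from those after it. -/
lemma exists_countP_eq_of_sort_gap (s : Multiset ℝ) {r : ℕ} (hr1 : 1 ≤ r) (hr : r < s.card)
    (hgap : (s.sort (· ≥ ·)).getD r 0 < (s.sort (· ≥ ·)).getD (r - 1) 0) :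
    ∃ c : ℝ, s.countP (fun x => c ≤ x) = r := by
  set l := s.sort (· ≥ ·) with hl
  have hlen : l.length = s.card := Multiset.length_sort ..
  have hsort : l.Pairwise (· ≥ ·) := Multiset.pairwise_sort ..
  have h1 : r < l.length := hlen ▸ hr
  have h2 : r - 1 < l.length := by omega
  rw [List.getD_eq_getElem _ _ h1, List.getD_eq_getElem _ _ h2] at hgap
  have hanti : ∀ i j (hi : i < l.length) (hj : j < l.length), i ≤ j → l[j] ≤ l[i] := by
    intro i j hi hj hij
    rcases hij.eq_or_lt with rfl | hij
    · exact le_rfl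
    · exact List.pairwise_iff_getElem.1 hsort i j hi hj hij
  -- Indices start at zero, so this is the `r`-th largest entry; the gap keeps all later entries
  -- below it.
  refine ⟨l[r - 1], ?_⟩
  have hsl : s = (l : Multiset ℝ) := (Multiset.sort_eq ..).symm
  generalize hc : l[r - 1] = c at *
  rw [hsl, Multiset.coe_countP, ← List.take_append_drop r l, List.countP_append]
  have e1 : (l.take r).countP (fun x => decide (c ≤ x)) = r := by
    rw [List.countP_eq_length.2, List.length_take, min_eq_left h1.le]
    intro x hx
    obtain ⟨i, hi, rfl⟩ := List.mem_take_iff_getElem.1 hx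
    exact decide_eq_true (hc ▸ hanti _ _ _ _ (by omega))
  have e2 : (l.drop r).countP (fun x => decide (c ≤ x)) = 0 := by
    rw [List.countP_eq_zero]
    intro x hx
    obtain ⟨i, hi, rfl⟩ := List.mem_drop_iff_getElem.1 hx
    have := hanti r (r + i) h1 (by omega) (by omega)
    rw [decide_eq_true_eq, not_le]
    exact this.trans_lt hgap
  rw [e1, e2, add_zero]

open Classical in
/-- Counting criterion: if `s` dominates `t` and `s` consists of as many elements as lie to the
right of some vertical line, then `t` lies in the open left half plane iff there are no more
unstable elements than elements of `s`. -/
lemma forall_re_neg_iff {s t : Multiset ℂ} {r : ℕ} (hs : s.card = r) {c : ℝ}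
    (hc : (s + t).countP (fun z => c ≤ z.re) = r) (hdom : ∀ ν ∈ s, ∀ μ ∈ t, μ.re ≤ ν.re) :
    (∀ μ ∈ t, μ.re < 0) ↔ (s + t).countP (fun z => 0 ≤ z.re) ≤ r := by
  -- An element of `t` reaching `c` would pull all `r` elements of `s` past `c` by dominance, giving
  -- more than `r` in total.
  have ht : ∀ μ ∈ t, μ.re < c := by
    intro μ hμ
    by_contra! hμc
    have h1 : 0 < t.countP (fun z => c ≤ z.re) := Multiset.countP_pos.2 ⟨μ, hμ, hμc⟩
    have h2 : s.countP (fun z => c ≤ z.re) = s.card :=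
      Multiset.countP_eq_card.2 fun ν hν => hμc.trans (hdom ν hν μ hμ)
    rw [Multiset.countP_add] at hc
    omega
  have hs' : ∀ ν ∈ s, c ≤ ν.re := by
    have h1 : t.countP (fun z => c ≤ z.re) = 0 :=
      Multiset.countP_eq_zero.2 fun μ hμ => not_le.2 (ht μ hμ)
    rw [Multiset.countP_add, h1, add_zero, ← hs] at hc
    exact Multiset.countP_eq_card.1 hc
  rw [Multiset.countP_add]
  constructor
  · intro h
    have h1 : t.countP (fun z => 0 ≤ z.re) = 0 :=
      Multiset.countP_eq_zero.2 fun μ hμ => not_le.2 (h μ hμ)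
    rw [h1, add_zero, ← hs]
    exact Multiset.countP_le_card _ _
  · intro h μ hμ
    by_contra! hμ0
    have h1 : 0 < t.countP (fun z => 0 ≤ z.re) := Multiset.countP_pos.2 ⟨μ, hμ, hμ0⟩
    have h2 : s.countP (fun z => 0 ≤ z.re) = s.card :=
      Multiset.countP_eq_card.2 fun ν hν => hμ0.trans ((ht μ hμ).le.trans (hs' ν hν))
    omega

end Spectrum

/-! ### The matrix exponential: intertwining and generalized eigenvectors. -/

section MatrixExponential
variable {n m : Type*} [Fintype n] [DecidableEq n] [Fintype m] [DecidableEq m]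
  {𝕂 : Type*} [RCLike 𝕂]

open scoped Matrix.Norms.Operator in
lemma hasSum_exp (A : Matrix n n 𝕂) :
    HasSum (fun k : ℕ => (k.factorial⁻¹ : 𝕂) • A ^ k) (NormedSpace.exp A) :=
  NormedSpace.exp_series_hasSum_exp' A

lemma exp_add_of_commute (A B : Matrix n n 𝕂) (h : Commute A B) : 
  NormedSpace.exp (A+B) = NormedSpace.exp A * NormedSpace.exp B := Matrix.exp_add_of_commute A B h

open scoped Matrix.Norms.Operator in
lemma hasDerivAt_exp_apply (A : Matrix n n ℝ) (t : ℝ) (i j : n) :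
    HasDerivAt (fun s : ℝ => NormedSpace.exp (s • A) i j) ((A * NormedSpace.exp (t • A)) i j) t := by
  have h := hasDerivAt_exp_smul_const' (𝕂 := ℝ) A t
  exact hasDerivAt_pi.1 (hasDerivAt_pi.1 h i) j

open scoped Matrix.Norms.Operator in
lemma analyticAt_exp_apply (A : Matrix n n ℝ) (t : ℝ) (i j : n) :
    AnalyticAt ℝ (fun s : ℝ => NormedSpace.exp (s • A) i j) t := by
  have h : AnalyticAt ℝ (fun s : ℝ => NormedSpace.exp (s • A)) t :=
    (NormedSpace.exp_analytic (𝕂 := ℝ) (t • A)).comp (f := fun s : ℝ => s • A) (by fun_prop)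
  exact ((LinearMap.toContinuousLinearMap (Matrix.entryLinearMap ℝ ℝ i j)).analyticAt _).comp
    (f := fun s : ℝ => NormedSpace.exp (s • A)) h

open scoped Matrix.Norms.Operator in
lemma continuous_exp : Continuous (NormedSpace.exp : Matrix n n 𝕂 → Matrix n n 𝕂) :=
  NormedSpace.exp_continuous

open scoped Matrix.Norms.Operator in
lemma exp_map_algebraMap (A : Matrix n n ℝ) :
    (NormedSpace.exp A).map (algebraMap ℝ ℂ) = NormedSpace.exp (A.map (algebraMap ℝ ℂ)) := by
  have hc : Continuous ((algebraMap ℝ ℂ).mapMatrix : Matrix n n ℝ →+* Matrix n n ℂ) := by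
    exact Continuous.matrix_map continuous_id Complex.continuous_ofReal
  exact NormedSpace.map_exp ((algebraMap ℝ ℂ).mapMatrix : Matrix n n ℝ →+* Matrix n n ℂ) hc A

/-- The intertwining relation passes to powers and then to the series. It transfers invariant
subspaces and quotients from `A` to its exponential. -/
lemma exp_mul_of_intertwine {A : Matrix n n 𝕂} {B : Matrix m m 𝕂} {X : Matrix n m 𝕂}
    (h : A * X = X * B) : NormedSpace.exp A * X = X * NormedSpace.exp B := by
  have hp : ∀ k : ℕ, A ^ k * X = X * B ^ k := by
    intro k
    induction k with
    | zero => simp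
    | succ k ih => rw [pow_succ', Matrix.mul_assoc, ih, ← Matrix.mul_assoc, h, Matrix.mul_assoc,
        ← pow_succ']
  have h1 := (hasSum_exp A).map (AddMonoidHom.mk' (fun Y => Y * X) fun Y Z => Matrix.add_mul Y Z X)
    (show Continuous _ by simp only [AddMonoidHom.mk'_apply]; fun_prop)
  have h2 := (hasSum_exp B).map (AddMonoidHom.mk' (fun Y => X * Y) fun Y Z => Matrix.mul_add X Y Z)
    (show Continuous _ by simp only [AddMonoidHom.mk'_apply]; fun_prop)
  refine h1.unique (h2.congr_fun fun k => ?_)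
  simp [hp]

lemma exp_mulVec_of_pow_mulVec_eq_zero {N : Matrix n n 𝕂} {k : ℕ} {v : n → 𝕂}
    (h : N ^ k *ᵥ v = 0) :
    NormedSpace.exp N *ᵥ v =
      ∑ j ∈ Finset.range k, ((j.factorial : 𝕂)⁻¹) • (N ^ j *ᵥ v) := by
  have h1 := (hasSum_exp N).map (AddMonoidHom.mk' (fun Y => Y *ᵥ v) fun Y Z => Matrix.add_mulVec Y Z v)
    (show Continuous _ by simp only [AddMonoidHom.mk'_apply]; fun_prop)
  have h2 : ∀ j ∉ Finset.range k, ((j.factorial : 𝕂)⁻¹) • (N ^ j *ᵥ v) = 0 := by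
    intro j hj
    rw [Finset.mem_range, not_lt] at hj
    rw [← Nat.sub_add_cancel hj, pow_add, ← Matrix.mulVec_mulVec, h]
    simp
  refine h1.unique ((hasSum_sum_of_ne_finset_zero h2).congr_fun fun j => ?_)
  simp [Matrix.smul_mulVec]

/-- The exponential acts on generalized eigenvectors through a polynomial. -/
lemma exp_smul_mulVec_of_pow_mulVec_eq_zero {N : Matrix n n ℂ} {μ : ℂ} {k : ℕ} {v : n → ℂ}
    (h : (N - μ • 1) ^ k *ᵥ v = 0) (t : ℂ) :
    NormedSpace.exp (t • N) *ᵥ v = Complex.exp (t * μ) •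
      ∑ j ∈ Finset.range k, (t ^ j * (j.factorial : ℂ)⁻¹) • ((N - μ • 1) ^ j *ᵥ v) := by
  have h1 : t • N = (t * μ) • (1 : Matrix n n ℂ) + t • (N - μ • 1) := by
    rw [smul_sub, smul_smul]; abel
  have h3 : NormedSpace.exp ((t * μ) • (1 : Matrix n n ℂ)) = Complex.exp (t * μ) • 1 := by
    rw [Matrix.smul_one_eq_diagonal, Matrix.exp_diagonal, Matrix.smul_one_eq_diagonal,
      Complex.exp_eq_exp_ℂ]
    congr 1
    funext i
    simp
  rw [h1, exp_add_of_commute _ _ ((Commute.one_left _).smul_left _), h3, ← Matrix.mulVec_mulVec,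
    exp_mulVec_of_pow_mulVec_eq_zero (k := k), Matrix.smul_mulVec, Matrix.one_mulVec]
  · congr 1
    refine Finset.sum_congr rfl fun j _ => ?_
    rw [smul_pow, Matrix.smul_mulVec, smul_smul, mul_comm]
  · rw [smul_pow, Matrix.smul_mulVec, h, smul_zero]

lemma exp_mulVec_of_mulVec_eq_smul {N : Matrix n n ℂ} {μ : ℂ} {v : n → ℂ}
    (h : N *ᵥ v = μ • v) (t : ℂ) :
    NormedSpace.exp (t • N) *ᵥ v = Complex.exp (t * μ) • v := by
  have := exp_smul_mulVec_of_pow_mulVec_eq_zero (N := N) (μ := μ) (k := 1) (v := v)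
    (by simp [Matrix.sub_mulVec, Matrix.smul_mulVec, h]) t
  simpa using this

end MatrixExponential

/-! ### The sampled system: spectrum and noise covariance. -/

section SampledSystem

/-- Spectral mapping for the sampled state matrix. -/
lemma mem_eigenvalues_discA {n : ℕ} {A : Matrix (Fin n) (Fin n) ℝ} {h : ℝ} {z : ℂ} :
    z ∈ eigenvalues (discA A h) ↔ ∃ μ ∈ eigenvalues A, z = Complex.exp (h * μ) := by
  set Ac := A.map (algebraMap ℝ ℂ) with hAc
  have hE : (discA A h).map (algebraMap ℝ ℂ) = NormedSpace.exp ((h : ℂ) • Ac) := by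
    rw [discA, exp_map_algebraMap]
    congr 1
    ext i j
    simp [hAc]
  constructor
  · intro hz
    obtain ⟨v, hv, hvz⟩ := mem_eigenvalues_iff_mulVec.1 hz
    rw [hE] at hvz
    set f := Matrix.toLin' Ac
    set g := Matrix.toLin' (NormedSpace.exp ((h : ℂ) • Ac)) with hg
    have hcomm : Commute g f := by
      have h1 := exp_mul_of_intertwine (A := (h : ℂ) • Ac) (B := (h : ℂ) • Ac) (X := Ac) (by simp)
      rw [commute_iff_eq, Module.End.mul_eq_comp, Module.End.mul_eq_comp, ← Matrix.toLin'_mul,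
        ← Matrix.toLin'_mul, h1]
    -- The eigenspace of the exponential is invariant under the commuting matrix `Ac`, which
    -- therefore has an eigenvector in it.
    have hmaps : ∀ x ∈ Module.End.eigenspace g z, f x ∈ Module.End.eigenspace g z :=
      Module.End.mapsTo_genEigenspace_of_comm hcomm z 1
    have hvm : v ∈ Module.End.eigenspace g z := by
      rw [Module.End.mem_eigenspace_iff, hg, Matrix.toLin'_apply, hvz]
    have : Nontrivial (Module.End.eigenspace g z) :=
      ⟨⟨⟨v, hvm⟩, 0, fun h => hv (congrArg Subtype.val h)⟩⟩
    obtain ⟨μ, hμ⟩ := Module.End.exists_eigenvalue (f.restrict hmaps)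
    obtain ⟨w, hw⟩ := hμ.exists_hasEigenvector
    have hw1 : Ac *ᵥ (w : Fin n → ℂ) = μ • (w : Fin n → ℂ) := by
      have := congrArg Subtype.val (Module.End.mem_eigenspace_iff.1 hw.1)
      simpa [f] using this
    have hw0 : (w : Fin n → ℂ) ≠ 0 := fun h => hw.2 (Subtype.ext h)
    have hw2 : NormedSpace.exp ((h : ℂ) • Ac) *ᵥ (w : Fin n → ℂ) = z • (w : Fin n → ℂ) := by
      exact Module.End.mem_eigenspace_iff.1 w.2
    rw [exp_mulVec_of_mulVec_eq_smul hw1] at hw2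
    exact ⟨μ, mem_eigenvalues_iff_mulVec.2 ⟨w, hw0, hw1⟩, (smul_left_injective ℂ hw0 hw2).symm⟩
  · rintro ⟨μ, hμ, rfl⟩
    obtain ⟨v, hv, hvz⟩ := mem_eigenvalues_iff_mulVec.1 hμ
    exact mem_eigenvalues_iff_mulVec.2 ⟨v, hv, by rw [hE, exp_mulVec_of_mulVec_eq_smul hvz]⟩

lemma isSchurStable_discA_iff {n : ℕ} {A : Matrix (Fin n) (Fin n) ℝ} {h : ℝ} (hh : 0 < h) :
    IsSchurStable (discA A h) ↔ ∀ μ ∈ eigenvalues A, μ.re < 0 := by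
  have key : ∀ μ : ℂ, ‖Complex.exp (h * μ)‖ < 1 ↔ μ.re < 0 := by
    intro μ
    rw [Complex.norm_exp, Real.exp_lt_one_iff]
    simp [mul_neg_iff, hh, hh.le, not_lt.2]
  simp only [IsSchurStable, mem_eigenvalues_discA]
  constructor
  · intro H μ hμ
    exact (key μ).1 (H _ ⟨μ, hμ, rfl⟩)
  · rintro H _ ⟨μ, hμ, rfl⟩
    exact (key μ).2 (H μ hμ)

lemma exists_leftInverse_of_rank_eq {ι : Type*} [Fintype ι] [DecidableEq ι] {n : ℕ}
    {M : Matrix ι (Fin n) ℝ} (hM : M.rank = n) : ∃ L : Matrix (Fin n) ι ℝ, L * M = 1 := by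
  have h1 : LinearMap.ker M.mulVecLin = ⊥ := by
    have h2 := M.mulVecLin.finrank_range_add_finrank_ker
    rw [← Matrix.rank, hM, Module.finrank_fin_fun] at h2
    exact Submodule.finrank_eq_zero.1 (by omega)
  obtain ⟨g, hg⟩ := LinearMap.exists_leftInverse_of_injective _ h1
  refine ⟨LinearMap.toMatrix' g, ?_⟩
  have := congrArg LinearMap.toMatrix' hg
  rwa [LinearMap.toMatrix'_comp, LinearMap.toMatrix'_id, ← Matrix.toLin'_apply',
    LinearMap.toMatrix'_toLin'] at this

section NoiseCov

variable {n q : ℕ} {A : Matrix (Fin n) (Fin n) ℝ} {G : Matrix (Fin n) (Fin q) ℝ} {h : ℝ}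

/-- The output `Gᵀ exp (Aᵀ τ) x` of the dual system. -/
noncomputable def dualOutput (A : Matrix (Fin n) (Fin n) ℝ) (G : Matrix (Fin n) (Fin q) ℝ)
    (x : Fin n → ℝ) (τ : ℝ) : Fin q → ℝ :=
  x ᵥ* (NormedSpace.exp (τ • A) * G)

lemma continuous_exp_smul (A : Matrix (Fin n) (Fin n) ℝ) :
    Continuous fun τ : ℝ => NormedSpace.exp (τ • A) :=
  continuous_exp.comp (by fun_prop)

lemma continuous_dualOutput (x : Fin n → ℝ) : Continuous (dualOutput A G x) := by
  have := continuous_exp_smul A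
  unfold dualOutput
  fun_prop

lemma exp_smul_transpose (A : Matrix (Fin n) (Fin n) ℝ) (τ : ℝ) :
    NormedSpace.exp (τ • Aᵀ) = (NormedSpace.exp (τ • A))ᵀ := by
  rw [← Matrix.exp_transpose, Matrix.transpose_smul]

/-- The covariance form is the energy of the dual output over one sampling period, so its kernel
consists of the vectors with silent output. -/
lemma quad_noiseCov (x : Fin n → ℝ) : quad (noiseCov A G h) x =
    ∫ τ in (0 : ℝ)..h, dualOutput A G x τ ⬝ᵥ dualOutput A G x τ := by
  have hc := continuous_exp_smul A
  have hct := continuous_exp_smul Aᵀ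
  have hi : ∀ i j, Continuous fun τ : ℝ =>
      (NormedSpace.exp (τ • A) * G * Gᵀ * NormedSpace.exp (τ • Aᵀ)) i j := by
    intro i j
    exact Continuous.matrix_elem (by fun_prop) i j
  have e : ∀ τ : ℝ, dualOutput A G x τ ⬝ᵥ dualOutput A G x τ = ∑ i, ∑ j,
      x i * (x j * (NormedSpace.exp (τ • A) * G * Gᵀ * NormedSpace.exp (τ • Aᵀ)) i j) := by
    intro τ
    have : dualOutput A G x τ ⬝ᵥ dualOutput A G x τ =
        quad (NormedSpace.exp (τ • A) * G * Gᵀ * NormedSpace.exp (τ • Aᵀ)) x := by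
      rw [quad, exp_smul_transpose, Matrix.mul_assoc, ← Matrix.transpose_mul,
        ← Matrix.mulVec_mulVec, Matrix.dotProduct_mulVec, Matrix.mulVec_transpose]
      rfl
    rw [this]
    simp only [quad, dotProduct, Matrix.mulVec, Finset.mul_sum]
    exact Finset.sum_congr rfl fun i _ => Finset.sum_congr rfl fun j _ => by ring
  simp only [e]
  rw [intervalIntegral.integral_finsetSum]
  · simp only [quad, dotProduct, Matrix.mulVec, Finset.mul_sum]
    refine Finset.sum_congr rfl fun i _ => ?_
    rw [intervalIntegral.integral_finsetSum]
    · refine Finset.sum_congr rfl fun j _ => ?_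
      rw [intervalIntegral.integral_const_mul, intervalIntegral.integral_const_mul]
      simp only [noiseCov, Matrix.of_apply]
      ring
    · intro j _
      exact ((((hi i j).const_mul _).const_mul _)).intervalIntegrable _ _
  · intro i _
    exact (continuous_finsetSum _ fun j _ =>
      ((hi i j).const_mul _).const_mul _).intervalIntegrable _ _

lemma noiseCov_posSemidef (hh : 0 ≤ h) : (noiseCov A G h).PosSemidef := by
  refine Matrix.PosSemidef.of_dotProduct_mulVec_nonneg ?_ fun x => ?_
  · rw [Matrix.IsHermitian, Matrix.conjTranspose_eq_transpose_of_trivial]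
    ext i j
    simp only [noiseCov, Matrix.transpose_apply, Matrix.of_apply]
    congr 1
    funext τ
    rw [← Matrix.transpose_apply (_ * _), exp_smul_transpose]
    simp only [Matrix.transpose_mul, Matrix.transpose_transpose, Matrix.mul_assoc]
  · have := quad_noiseCov (A := A) (G := G) (h := h) x
    rw [star_trivial, ← quad, this]
    exact intervalIntegral.integral_nonneg hh fun τ _ => dotProduct_self_star_nonneg _

/-- Zero energy silences the output on `(0, h)`, and analyticity in time extends this to every `τ`.
-/
lemma dualOutput_eq_zero_of_quad_eq_zero (hh : 0 < h) {x : Fin n → ℝ}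
    (hx : quad (noiseCov A G h) x = 0) (τ : ℝ) : dualOutput A G x τ = 0 := by
  rw [quad_noiseCov] at hx
  have hcont : Continuous fun τ => dualOutput A G x τ ⬝ᵥ dualOutput A G x τ := by
    have := continuous_dualOutput (A := A) (G := G) x
    fun_prop
  have h0 : ∀ τ ∈ Set.Ioo 0 h, dualOutput A G x τ = 0 := by
    intro τ hτ
    by_contra hne
    refine (intervalIntegral.integral_pos hh hcont.continuousOn
      (fun t _ => dotProduct_self_star_nonneg _) ⟨τ, Set.Ioo_subset_Icc_self hτ, ?_⟩).ne' hx
    exact lt_of_le_of_ne (dotProduct_self_star_nonneg _)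
      fun h => hne (dotProduct_self_eq_zero.1 h.symm)
  funext j
  have han : AnalyticOnNhd ℝ (fun τ => dualOutput A G x τ j) Set.univ := by
    intro t _
    have : (fun τ => dualOutput A G x τ j) =
        fun τ : ℝ => ∑ i, x i * ∑ k, NormedSpace.exp (τ • A) i k * G k j := by
      funext τ
      simp [dualOutput, Matrix.vecMul, dotProduct, Matrix.mul_apply]
    rw [this]
    refine Finset.analyticAt_fun_sum _ fun i _ => analyticAt_const.mul ?_
    exact Finset.analyticAt_fun_sum _ fun k _ => (analyticAt_exp_apply A t i k).mul analyticAt_const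
  refine han.eqOn_zero_of_preconnected_of_eventuallyEq_zero isPreconnected_univ
    (Set.mem_univ (h / 2)) ?_ (Set.mem_univ τ)
  filter_upwards [Ioo_mem_nhds (half_pos hh) (half_lt_self hh)] with t ht
  rw [h0 t ht]; rfl

open scoped MatrixOrder in
lemma discG_mul_transpose (hh : 0 ≤ h) :
    discG A G h * (discG A G h)ᵀ = noiseCov A G h := by
  have h1 : (discG A G h)ᵀ = discG A G h :=
    transpose_of_posSemidef (Matrix.nonneg_iff_posSemidef.1 (CFC.sqrt_nonneg (noiseCov A G h)))
  rw [h1]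
  exact CFC.sqrt_mul_sqrt_self _ (noiseCov_posSemidef hh).nonneg

/-- Reachability of the sampled pair makes the sampled noise covariance positive definite. -/
lemma noiseCov_posDef (hh : 0 < h) (hreach : IsReachable (discA A h) (discG A G h)) :
    (noiseCov A G h).PosDef := by
  have hps := noiseCov_posSemidef (A := A) (G := G) hh.le
  refine Matrix.PosDef.of_dotProduct_mulVec_pos hps.isHermitian fun x hx => ?_
  refine lt_of_le_of_ne (hps.dotProduct_mulVec_nonneg x) fun h0 => hx ?_
  have hz := dualOutput_eq_zero_of_quad_eq_zero (A := A) (G := G) hh (x := x)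
    (by simpa [quad] using h0.symm)
  have hk : ∀ k : ℕ, (x ᵥ* discA A h ^ k) ᵥ* discG A G h = 0 := by
    intro k
    have h1 : quad (noiseCov A G h) (x ᵥ* discA A h ^ k) = 0 := by
      rw [quad_noiseCov]
      have : ∀ τ, dualOutput A G (x ᵥ* discA A h ^ k) τ = 0 := by
        intro τ
        -- Multiplying `x` by the `k`-th power of the sampled matrix shifts its output by `k * h`,
        -- beyond the first sampling window. Hence the kernel of the covariance is invariant, and
        -- reachability forces it to be zero.
        have := hz (k * h + τ)
        rw [dualOutput, add_smul, exp_add_of_commute _ _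
          (((Commute.refl A).smul_left _).smul_right _), mul_smul,
          Nat.cast_smul_eq_nsmul ℝ k, Matrix.exp_nsmul] at this
        rw [dualOutput, Matrix.vecMul_vecMul, ← Matrix.mul_assoc]
        exact this
      simp [this]
    rw [← discG_mul_transpose hh.le, quad, ← Matrix.mulVec_mulVec, Matrix.dotProduct_mulVec,
      Matrix.mulVec_transpose] at h1
    exact dotProduct_self_eq_zero.1 h1
  obtain ⟨L, hL⟩ := exists_leftInverse_of_rank_eq ((Matrix.rank_transpose _).trans hreach)
  have h2 : (Matrix.of fun (i : Fin n) (kj : Fin n × Fin n) =>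
      (discA A h ^ (kj.1 : ℕ) * discG A G h) i kj.2)ᵀ *ᵥ x = 0 := by
    funext kj
    rw [Matrix.mulVec_transpose]
    have := congrFun (hk kj.1) kj.2
    rwa [Matrix.vecMul_vecMul] at this
  rw [← Matrix.one_mulVec x, ← hL, ← Matrix.mulVec_mulVec, h2, Matrix.mulVec_zero]

end NoiseCov

end SampledSystem

/-! ### Global solutions of linear differential equations by the Dyson series. -/

section LinearODE

variable {E : Type*} [NormedAddCommGroup E] [NormedSpace ℝ E]

/-- The terms of the Dyson series of the linear differential equation `x' = B x`. -/
noncomputable def dysonTerm (B : ℝ → E →L[ℝ] E) (x₀ : E) : ℕ → ℝ → E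
  | 0, _ => x₀
  | k + 1, t => ∫ s in (0 : ℝ)..t, B s (dysonTerm B x₀ k s)

variable {B : ℝ → E →L[ℝ] E} {x₀ : E}

lemma continuous_dysonTerm (hB : Continuous B) (k : ℕ) : Continuous (dysonTerm B x₀ k) := by
  induction k with
  | zero => exact continuous_const
  | succ k ih =>
    exact intervalIntegral.continuous_primitive
      (fun a b => (hB.clm_apply ih).intervalIntegrable a b) 0

lemma hasDerivAt_dysonTerm_succ [CompleteSpace E] (hB : Continuous B) (k : ℕ) (t : ℝ) :
    HasDerivAt (dysonTerm B x₀ (k + 1)) (B t (dysonTerm B x₀ k t)) t :=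
  (hB.clm_apply (continuous_dysonTerm hB k)).integral_hasStrictDerivAt 0 t |>.hasDerivAt

/-- Each iterated integral gains a factor `K * |t| / (k + 1)`, so the series is dominated by an
exponential series. -/
lemma norm_dysonTerm_le {T K : ℝ} (hK0 : 0 ≤ K)
    (hK : ∀ s ∈ Set.Icc (-T) T, ‖B s‖ ≤ K) (k : ℕ) {t : ℝ} (ht : |t| ≤ T) :
    ‖dysonTerm B x₀ k t‖ ≤ ‖x₀‖ * ((K * |t|) ^ k / k.factorial) := by
  induction k generalizing t with
  | zero => simp [dysonTerm]
  | succ k ih =>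
    have hsub : ∀ s ∈ Set.uIoc 0 t, |s| ≤ T := by
      intro s hs
      refine le_trans ?_ ht
      have := Set.abs_sub_left_of_mem_uIcc (Set.uIoc_subset_uIcc hs)
      simpa using this
    calc ‖dysonTerm B x₀ (k + 1) t‖
        ≤ ∫ s in Set.uIoc 0 t, ‖B s (dysonTerm B x₀ k s)‖ :=
          intervalIntegral.norm_integral_le_integral_norm_uIoc
      _ ≤ ∫ s in Set.uIoc 0 t, ‖x₀‖ * K ^ (k + 1) / k.factorial * |s - 0| ^ k := by
          refine MeasureTheory.integral_mono_of_nonneg (Filter.Eventually.of_forall fun s =>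
            norm_nonneg _) ?_ ?_
          · refine Continuous.integrableOn_uIoc ?_
            fun_prop
          · refine (MeasureTheory.ae_restrict_iff' measurableSet_uIoc).2
              (Filter.Eventually.of_forall fun s hs => ?_)
            have h1 := ih (hsub s hs)
            have h2 := hK s (abs_le.1 (hsub s hs))
            calc ‖B s (dysonTerm B x₀ k s)‖ ≤ ‖B s‖ * ‖dysonTerm B x₀ k s‖ :=
                  (B s).le_opNorm _
              _ ≤ K * (‖x₀‖ * ((K * |s|) ^ k / k.factorial)) := by gcongr
              _ = ‖x₀‖ * K ^ (k + 1) / k.factorial * |s - 0| ^ k := by rw [sub_zero]; ring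
      _ = ‖x₀‖ * ((K * |t|) ^ (k + 1) / (k + 1).factorial) := by
          rw [MeasureTheory.integral_const_mul, integral_pow_abs_sub_uIoc, sub_zero,
            Nat.factorial_succ]
          push_cast
          field_simp
          ring

/-- Global existence for linear differential equations. -/
lemma exists_hasDerivAt_linear [CompleteSpace E] (hB : Continuous B) (x₀ : E) :
    ∃ x : ℝ → E, x 0 = x₀ ∧ ∀ t, HasDerivAt x (B t (x t)) t := by
  have hbound : ∀ T : ℝ, ∃ K, 0 ≤ K ∧ ∀ s ∈ Set.Icc (-T) T, ‖B s‖ ≤ K := by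
    intro T
    obtain ⟨K, hK⟩ := isCompact_Icc.exists_bound_of_continuousOn (s := Set.Icc (-T) T)
      hB.continuousOn
    exact ⟨max K 0, le_max_right _ _, fun s hs => (hK s hs).trans (le_max_left _ _)⟩
  have hsum : ∀ t, Summable fun k => dysonTerm B x₀ k t := by
    intro t
    obtain ⟨K, hK0, hK⟩ := hbound |t|
    exact Summable.of_norm_bounded ((Real.summable_pow_div_factorial _).mul_left _)
      fun k => norm_dysonTerm_le hK0 hK k le_rfl
  refine ⟨fun t => ∑' k, dysonTerm B x₀ k t, ?_, fun t => ?_⟩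
  · refine (tsum_eq_single 0 fun k hk => ?_).trans rfl
    obtain ⟨k, rfl⟩ := Nat.exists_eq_succ_of_ne_zero hk
    simp [dysonTerm]
  · set T := |t| + 1 with hT
    obtain ⟨K, hK0, hK⟩ := hbound T
    have htT : t ∈ Set.Ioo (-T) T := abs_lt.1 (lt_add_one |t|)
    -- The term of index zero is constant, hence the zero derivative; the others shift the index by
    -- one.
    let g' : ℕ → ℝ → E := fun k s => Nat.casesOn k 0 fun j => B s (dysonTerm B x₀ j s)
    let u : ℕ → ℝ := fun k => Nat.casesOn k 0
      fun j => K * (‖x₀‖ * ((K * T) ^ j / j.factorial))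
    have hu : Summable u := (summable_nat_add_iff 1).1
      (((Real.summable_pow_div_factorial (K * T)).mul_left _).mul_left _)
    have hd := hasDerivAt_tsum_of_isPreconnected (g := dysonTerm B x₀) (g' := g') hu isOpen_Ioo
      isPreconnected_Ioo (t := Set.Ioo (-T) T) (y₀ := t) (y := t) ?_ ?_ htT (hsum t) htT
    · convert hd using 1
      have h1 : Summable fun k => B t (dysonTerm B x₀ k t) := (B t).summable (hsum t)
      have h2 : Summable fun k => g' k t := (summable_nat_add_iff 1).1 h1
      rw [h2.tsum_eq_zero_add, (B t).map_tsum (hsum t)]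
      exact (zero_add _).symm
    · rintro (_ | k) s _
      · exact hasDerivAt_const s x₀
      · exact hasDerivAt_dysonTerm_succ hB k s
    · rintro (_ | k) s hs
      · simp [g', u]
      · have hs' : |s| ≤ T := (abs_lt.2 hs).le
        calc ‖B s (dysonTerm B x₀ k s)‖ ≤ ‖B s‖ * ‖dysonTerm B x₀ k s‖ := (B s).le_opNorm _
          _ ≤ K * (‖x₀‖ * ((K * |s|) ^ k / k.factorial)) := by
            have := norm_dysonTerm_le (x₀ := x₀) hK0 hK k hs'
            have := hK s (abs_le.1 hs')
            gcongr
          _ ≤ K * (‖x₀‖ * ((K * T) ^ k / k.factorial)) := by gcongr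

open scoped Matrix.Norms.Operator in
/-- Global existence for linear matrix differential equations. -/
lemma exists_matrix_hasDerivAt {r : Type*} [Fintype r] [DecidableEq r] {β : ℝ → Matrix r r ℝ}
    (hβ : Continuous β) : ∃ S : ℝ → Matrix r r ℝ, S 0 = 1 ∧
      ∀ t i j, HasDerivAt (fun s => S s i j) ((β t * S t) i j) t := by
  obtain ⟨S, h0, hS⟩ := exists_hasDerivAt_linear
    (B := fun t => ContinuousLinearMap.mul ℝ (Matrix r r ℝ) (β t))
    ((ContinuousLinearMap.mul ℝ (Matrix r r ℝ)).continuous.comp hβ) 1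
  exact ⟨S, h0, fun t i j => hasDerivAt_pi.1 (hasDerivAt_pi.1 (hS t) i) j⟩

end LinearODE

-- The operator norm makes matrices a C⋆-algebra, where the square root is continuous on the
-- nonnegative cone.
open scoped Matrix.Norms.L2Operator MatrixOrder in
lemma tendsto_sqrt {ι r : Type*} [Fintype r] [DecidableEq r] {l : Filter ι}
    {f : ι → Matrix r r ℝ} {N : Matrix r r ℝ} (hN : N.PosSemidef) (hf : ∀ i, (f i).PosSemidef)
    (h : Filter.Tendsto f l (𝓝 N)) :
    Filter.Tendsto (fun i => CFC.sqrt (f i)) l (𝓝 (CFC.sqrt N)) := by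
  have h1 := (CFC.continuousOn_sqrt (A := Matrix r r ℝ)).continuousWithinAt (x := N) hN.nonneg
  exact h1.tendsto.comp
    (tendsto_nhdsWithin_iff.2 ⟨h, Filter.Eventually.of_forall fun i => (hf i).nonneg⟩)

/-! ### Entrywise calculus of matrix curves. -/

section MatrixCurves

variable {l m n : Type*} [Fintype m]

/-- Entrywise derivative of a matrix-valued curve. -/
def HasMatrixDeriv (Y : ℝ → Matrix l m ℝ) (Y' : Matrix l m ℝ) (t : ℝ) : Prop :=
  ∀ i j, HasDerivAt (fun s => Y s i j) (Y' i j) t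

lemma HasMatrixDeriv.mul {X : ℝ → Matrix l m ℝ} {Y : ℝ → Matrix m n ℝ} {X' : Matrix l m ℝ}
    {Y' : Matrix m n ℝ} {t : ℝ} (hX : HasMatrixDeriv X X' t) (hY : HasMatrixDeriv Y Y' t) :
    HasMatrixDeriv (fun s => X s * Y s) (X' * Y t + X t * Y') t := by
  intro i j
  simp only [Matrix.mul_apply, Matrix.add_apply, ← Finset.sum_add_distrib]
  exact HasDerivAt.fun_sum fun k _ => (hX i k).mul (hY k j)

lemma HasMatrixDeriv.transpose {X : ℝ → Matrix l m ℝ} {X' : Matrix l m ℝ} {t : ℝ}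
    (hX : HasMatrixDeriv X X' t) : HasMatrixDeriv (fun s => (X s)ᵀ) X'ᵀ t :=
  fun i j => hX j i

lemma hasMatrixDeriv_const (X : Matrix l m ℝ) (t : ℝ) : HasMatrixDeriv (fun _ => X) 0 t :=
  fun _ _ => hasDerivAt_const _ _

lemma eq_of_hasMatrixDeriv_zero {X : ℝ → Matrix l m ℝ} (hX : ∀ t, HasMatrixDeriv X 0 t)
    (s t : ℝ) : X s = X t := by
  ext i j
  exact is_const_of_deriv_eq_zero (f := fun s => X s i j)
    (fun t => (hX t i j).differentiableAt) (fun t => (hX t i j).deriv) s t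

lemma posDef_transpose_mul_self {n r : Type*} [Fintype n] [Fintype r] {Y : Matrix n r ℝ}
    (hY : ∀ x, Y *ᵥ x = 0 → x = 0) : (Yᵀ * Y).PosDef := by
  have h1 := Matrix.posSemidef_conjTranspose_mul_self Y
  rw [Matrix.conjTranspose_eq_transpose_of_trivial] at h1
  refine Matrix.PosDef.of_dotProduct_mulVec_pos h1.isHermitian fun x hx =>
    lt_of_le_of_ne (h1.dotProduct_mulVec_nonneg x) fun h0 => hx (hY x ?_)
  rw [star_trivial, ← Matrix.mulVec_mulVec, Matrix.dotProduct_mulVec, Matrix.vecMul_transpose] at h0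
  exact dotProduct_self_eq_zero.1 h0.symm

end MatrixCurves

/-! ### Orbits of the Oja flow and their column spaces. -/

section OjaFlow

variable {n r : ℕ}

/-- The orthogonal projection onto the column space of `Y`. -/
noncomputable def colProj (Y : Matrix (Fin n) (Fin r) ℝ) : Matrix (Fin n) (Fin n) ℝ :=
  Y * (Yᵀ * Y)⁻¹ * Yᵀ

/-- Orthonormality forces `S * Sᵀ` to be the inverse Gram matrix of `Y`, so the projection does not
depend on the orthonormal basis. -/
lemma mul_transpose_eq_colProj {Y : Matrix (Fin n) (Fin r) ℝ} {S : Matrix (Fin r) (Fin r) ℝ}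
    (h : (Y * S)ᵀ * (Y * S) = 1) : (Y * S) * (Y * S)ᵀ = colProj Y := by
  have h1 : (Sᵀ * (Yᵀ * Y)) * S = 1 := by
    rw [← h, Matrix.transpose_mul]
    simp only [Matrix.mul_assoc]
  have h2 : (S * Sᵀ) * (Yᵀ * Y) = 1 := by
    rw [Matrix.mul_assoc]
    exact mul_eq_one_comm.1 h1
  rw [colProj, Matrix.inv_eq_left_inv h2, Matrix.transpose_mul]
  simp only [Matrix.mul_assoc]

lemma exp_mul_injective (A : Matrix (Fin n) (Fin n) ℝ) {Y : Matrix (Fin n) (Fin r) ℝ}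
    (hY : ∀ x, Y *ᵥ x = 0 → x = 0) (x : Fin r → ℝ)
    (hx : (NormedSpace.exp A * Y) *ᵥ x = 0) : x = 0 := by
  refine hY x ?_
  have h1 : NormedSpace.exp (-A) * NormedSpace.exp A = 1 := by
    rw [← exp_add_of_commute _ _ (Commute.neg_left (Commute.refl A)), neg_add_cancel, NormedSpace.exp_zero]
  have := congrArg (fun y => NormedSpace.exp (-A) *ᵥ y) hx
  simpa only [Matrix.mulVec_mulVec, ← Matrix.mul_assoc, h1, Matrix.one_mul,
    Matrix.mulVec_zero] using this

lemma injective_of_transpose_mul_self {Y : Matrix (Fin n) (Fin r) ℝ} (hY : Yᵀ * Y = 1)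
    (x : Fin r → ℝ) (hx : Y *ᵥ x = 0) : x = 0 := by
  rw [← Matrix.one_mulVec x, ← hY, ← Matrix.mulVec_mulVec, hx, Matrix.mulVec_zero]

/-- Through every point of the Stiefel manifold there is a global orbit of the Oja flow, whose
column space moves by the linear flow. -/
lemma exists_isOjaOrbit (A : Matrix (Fin n) (Fin n) ℝ) (ε : ℝ) {V₀ : Matrix (Fin n) (Fin r) ℝ}
    (hV₀ : V₀ ∈ stiefel r n) : ∃ V : ℝ → Matrix (Fin n) (Fin r) ℝ, IsOjaOrbit A ε V ∧ V 0 = V₀ ∧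
      ∀ t, V t ∈ stiefel r n ∧
        ∃ S : Matrix (Fin r) (Fin r) ℝ, V t = NormedSpace.exp ((t * ε⁻¹) • A) * V₀ * S := by
  set B : Matrix (Fin n) (Fin n) ℝ := ε⁻¹ • A with hB
  obtain ⟨Y, hYdef⟩ : ∃ Y : ℝ → Matrix (Fin n) (Fin r) ℝ,
      ∀ t, Y t = NormedSpace.exp (t • B) * V₀ := ⟨_, fun _ => rfl⟩
  have hYcont : Continuous Y := by
    have := continuous_exp_smul B
    rw [funext hYdef]
    fun_prop
  have hYderiv : ∀ t, HasMatrixDeriv Y (B * Y t) t := by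
    intro t
    have h1 : HasMatrixDeriv (fun s => NormedSpace.exp (s • B)) (B * NormedSpace.exp (t • B)) t :=
      hasDerivAt_exp_apply B t
    have h2 := h1.mul (hasMatrixDeriv_const V₀ t)
    rw [Matrix.mul_zero, add_zero, Matrix.mul_assoc] at h2
    rwa [funext hYdef]
  have hN : ∀ t, IsUnit ((Y t)ᵀ * Y t).det := fun t => by
    rw [hYdef]
    exact (posDef_transpose_mul_self (exp_mul_injective _
      (injective_of_transpose_mul_self hV₀))).det_pos.ne'.isUnit
  -- Solving `S' = β S` makes `Y * S` move orthogonally to its column space. The nonlinear Oja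
  -- equation is thereby reduced to a linear one with a known coefficient.
  obtain ⟨β, hβdef⟩ : ∃ β : ℝ → Matrix (Fin r) (Fin r) ℝ,
      ∀ t, β t = -(((Y t)ᵀ * Y t)⁻¹ * (Y t)ᵀ * B * Y t) := ⟨_, fun _ => rfl⟩
  have hβ : Continuous β := by
    have hi : Continuous fun t => ((Y t)ᵀ * Y t)⁻¹ := by
      simp only [Matrix.inv_def, Ring.inverse_eq_inv']
      have h1 : Continuous fun t => (((Y t)ᵀ * Y t).det)⁻¹ :=
        Continuous.inv₀ (by fun_prop) fun t => (hN t).ne_zero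
      have h2 : Continuous fun t => ((Y t)ᵀ * Y t).adjugate :=
        Continuous.matrix_adjugate (by fun_prop)
      fun_prop
    rw [funext hβdef]
    fun_prop
  obtain ⟨S, hS0, hS⟩ := exists_matrix_hasDerivAt hβ
  have hS' : ∀ t, HasMatrixDeriv S (β t * S t) t := hS
  obtain ⟨V, hVdef⟩ : ∃ V : ℝ → Matrix (Fin n) (Fin r) ℝ, ∀ t, V t = Y t * S t :=
    ⟨_, fun _ => rfl⟩
  have hVderiv : ∀ t, HasMatrixDeriv V ((1 - colProj (Y t)) * B * V t) t := by
    intro t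
    have h1 := (hYderiv t).mul (hS' t)
    have h2 : B * Y t * S t + Y t * (β t * S t) = (1 - colProj (Y t)) * B * V t := by
      simp only [hβdef, hVdef, colProj, Matrix.sub_mul, Matrix.one_mul, Matrix.mul_assoc,
        Matrix.neg_mul, Matrix.mul_neg]
      abel
    rwa [h2, ← funext hVdef] at h1
  have hproj : ∀ t, colProj (Y t) * V t = V t := by
    intro t
    simp only [colProj, hVdef, Matrix.mul_assoc]
    rw [← Matrix.mul_assoc (Y t)ᵀ, ← Matrix.mul_assoc _⁻¹, Matrix.nonsing_inv_mul _ (hN t),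
      Matrix.one_mul]
  have hprojT : ∀ t, (colProj (Y t))ᵀ = colProj (Y t) := by
    intro t
    simp only [colProj, Matrix.transpose_mul, Matrix.transpose_nonsing_inv,
      Matrix.transpose_transpose, Matrix.mul_assoc]
  have hprojV : ∀ t, (V t)ᵀ * (1 - colProj (Y t)) = 0 := by
    intro t
    have := congrArg Matrix.transpose (hproj t)
    rw [Matrix.transpose_mul, hprojT] at this
    rw [Matrix.mul_sub, this, Matrix.mul_one, sub_self]
  have hconst : ∀ t, HasMatrixDeriv (fun s => (V s)ᵀ * V s) 0 t := by
    intro t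
    have h1 := (hVderiv t).transpose.mul (hVderiv t)
    have h2 : (V t)ᵀ * ((1 - colProj (Y t)) * B * V t) = 0 := by
      rw [← Matrix.mul_assoc, ← Matrix.mul_assoc, hprojV, Matrix.zero_mul, Matrix.zero_mul]
    have h3 : ((1 - colProj (Y t)) * B * V t)ᵀ * V t = 0 := by
      have := congrArg Matrix.transpose h2
      rwa [Matrix.transpose_mul, Matrix.transpose_transpose, Matrix.transpose_zero] at this
    rwa [h2, h3, add_zero] at h1
  have hY0 : Y 0 = V₀ := by simp [hYdef]
  have hV0 : V 0 = V₀ := by simp only [hVdef, hS0, hY0, Matrix.mul_one]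
  have hst : ∀ t, (V t)ᵀ * V t = 1 := by
    intro t
    rw [eq_of_hasMatrixDeriv_zero hconst t 0]
    simp only [hV0]
    exact hV₀
  refine ⟨V, ⟨by rw [hV0]; exact hV₀, fun t _ i j => ?_⟩, hV0, fun t => ⟨hst t, S t, ?_⟩⟩
  · have h1 := (hVderiv t i j).hasDerivWithinAt (s := Set.Ici 0)
    have h2 : (1 - colProj (Y t)) * B * V t = ε⁻¹ • ojaField A (V t) := by
      rw [ojaField, hVdef, mul_transpose_eq_colProj (hVdef t ▸ hst t), hB]
      simp only [Matrix.mul_smul, Matrix.smul_mul]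
    rw [h2] at h1
    exact h1
  · simp only [hVdef, hYdef, hB, smul_smul]

open scoped MatrixOrder in
/-- Matrices close to one with orthonormal columns can be orthonormalized by a small change. -/
lemma exists_orthonormalization {ι : Type*} {l : Filter ι} {f : ι → Matrix (Fin n) (Fin r) ℝ}
    {U : Matrix (Fin n) (Fin r) ℝ} (hf : ∀ i, ((f i)ᵀ * f i).PosDef)
    (hlim : Filter.Tendsto f l (𝓝 U)) (hU : Uᵀ * U = 1) :
    ∃ P : ι → Matrix (Fin r) (Fin r) ℝ, (∀ i, f i * P i ∈ stiefel r n) ∧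
      Filter.Tendsto (fun i => f i * P i) l (𝓝 U) := by
  set N : ι → Matrix (Fin r) (Fin r) ℝ := fun i => (f i)ᵀ * f i with hN
  have hNlim : Filter.Tendsto N l (𝓝 1) := by
    have hc : Continuous fun X : Matrix (Fin n) (Fin r) ℝ => Xᵀ * X := by fun_prop
    have := (hc.tendsto U).comp hlim
    rwa [hU] at this
  have hsq : ∀ i, CFC.sqrt (N i) * CFC.sqrt (N i) = N i := fun i =>
    CFC.sqrt_mul_sqrt_self _ (hf i).posSemidef.nonneg
  have hdet : ∀ i, IsUnit (CFC.sqrt (N i)).det := by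
    intro i
    have h := (hf i).det_pos.ne'
    change (N i).det ≠ 0 at h
    rw [← hsq, Matrix.det_mul] at h
    exact (left_ne_zero_of_mul h).isUnit
  have hsymm : ∀ i, (CFC.sqrt (N i))ᵀ = CFC.sqrt (N i) := fun i =>
    transpose_of_posSemidef (Matrix.nonneg_iff_posSemidef.1 (CFC.sqrt_nonneg (N i)))
  refine ⟨fun i => (CFC.sqrt (N i))⁻¹, fun i => ?_, ?_⟩
  · change (f i * (CFC.sqrt (N i))⁻¹)ᵀ * (f i * (CFC.sqrt (N i))⁻¹) = 1
    rw [Matrix.transpose_mul, Matrix.transpose_nonsing_inv, hsymm, Matrix.mul_assoc,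
      ← Matrix.mul_assoc (f i)ᵀ]
    change (CFC.sqrt (N i))⁻¹ * (N i * (CFC.sqrt (N i))⁻¹) = 1
    conv_lhs => enter [2, 1]; rw [← hsq]
    rw [Matrix.mul_assoc, Matrix.mul_nonsing_inv _ (hdet i), Matrix.mul_one,
      Matrix.nonsing_inv_mul _ (hdet i)]
  · have h1 := tendsto_sqrt Matrix.PosSemidef.one (fun i => (hf i).posSemidef) hNlim
    rw [CFC.sqrt_one] at h1
    have hc : ContinuousAt (fun X : Matrix (Fin r) (Fin r) ℝ => X⁻¹) 1 := by
      simp only [Matrix.inv_def, Ring.inverse_eq_inv']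
      have h1 : ContinuousAt (fun X : Matrix (Fin r) (Fin r) ℝ => (X.det)⁻¹) 1 :=
        ContinuousAt.inv₀ (by fun_prop) (by simp)
      have h2 : Continuous fun X : Matrix (Fin r) (Fin r) ℝ => X.adjugate :=
        Continuous.matrix_adjugate (by fun_prop)
      exact h1.smul h2.continuousAt
    have h2 := hc.tendsto.comp h1
    have hm : Continuous fun p : Matrix (Fin n) (Fin r) ℝ × Matrix (Fin r) (Fin r) ℝ =>
        p.1 * p.2 := by fun_prop
    have h3 := (hm.tendsto (U, 1⁻¹)).comp (hlim.prodMk_nhds h2)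
    simpa [Function.comp_def] using h3

/-- If the column space of `Y₀` converges to that of a point `U` of an asymptotically stable set
under the backward linear flow, then it is the column space of `U`. -/
lemma mul_transpose_mul_eq_of_tendsto {A : Matrix (Fin n) (Fin n) ℝ} {ε : ℝ} (hε : 0 < ε)
    {S : Set (Matrix (Fin n) (Fin r) ℝ)} (hS : IsAsymptoticallyStable A ε S)
    {U Y₀ : Matrix (Fin n) (Fin r) ℝ} (hU : U ∈ S) (B : Matrix (Fin r) (Fin r) ℝ)
    (hlim : Filter.Tendsto (fun T : ℝ => NormedSpace.exp ((-T) • A) * Y₀ * NormedSpace.exp (T • B))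
      Filter.atTop (𝓝 U)) : U * Uᵀ * Y₀ = Y₀ := by
  set Z : ℝ → Matrix (Fin n) (Fin r) ℝ :=
    fun T => NormedSpace.exp ((-T) • A) * Y₀ * NormedSpace.exp (T • B) with hZ
  have hUst : Uᵀ * U = 1 := (hS.subset_equilibria hU).1
  have hexpinv : ∀ {k : ℕ} (M : Matrix (Fin k) (Fin k) ℝ) (T : ℝ),
      NormedSpace.exp (T • M) * NormedSpace.exp ((-T) • M) = 1 := by
    intro k M T
    rw [← exp_add_of_commute _ _ (((Commute.refl M).smul_left _).smul_right _), ← add_smul,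
      add_neg_cancel, zero_smul, NormedSpace.exp_zero]
  have hZtZ : Filter.Tendsto (fun T => (Z T)ᵀ * Z T) Filter.atTop (𝓝 1) := by
    have hc : Continuous fun X : Matrix (Fin n) (Fin r) ℝ => Xᵀ * X := by fun_prop
    have := (hc.tendsto U).comp hlim
    rwa [hUst] at this
  -- The Gram matrix of `Z T` tends to the identity, so it is invertible for some `T`; this rules
  -- out a kernel of `Y₀`.
  have hY₀ : ∀ x, Y₀ *ᵥ x = 0 → x = 0 := by
    have hdet : Filter.Tendsto (fun T => ((Z T)ᵀ * Z T).det) Filter.atTop (𝓝 1) := by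
      have hc : Continuous fun X : Matrix (Fin r) (Fin r) ℝ => X.det := by fun_prop
      have := (hc.tendsto 1).comp hZtZ
      rwa [Matrix.det_one] at this
    obtain ⟨T, hT⟩ := (hdet.eventually_ne one_ne_zero).exists
    intro x hx
    have h1 : ((Z T)ᵀ * Z T) *ᵥ (NormedSpace.exp ((-T) • B) *ᵥ x) = 0 := by
      rw [Matrix.mulVec_mulVec, Matrix.mul_assoc, hZ]
      simp only [Matrix.mul_assoc, hexpinv, Matrix.mul_one]
      simp only [← Matrix.mulVec_mulVec, hx, Matrix.mulVec_zero]
    have h2 : NormedSpace.exp ((-T) • B) *ᵥ x = 0 := Matrix.eq_zero_of_mulVec_eq_zero hT h1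
    rw [← Matrix.one_mulVec x, ← hexpinv B T, ← Matrix.mulVec_mulVec, h2, Matrix.mulVec_zero]
  have hN₀ : IsUnit (Y₀ᵀ * Y₀).det := (posDef_transpose_mul_self hY₀).det_pos.ne'.isUnit
  have hZpos : ∀ T, ((Z T)ᵀ * Z T).PosDef := by
    intro T
    refine posDef_transpose_mul_self fun x hx => ?_
    rw [hZ] at hx
    simp only [Matrix.mul_assoc] at hx
    refine exp_mul_injective (T • B) (Y := 1) (fun x hx => by simpa using hx) x ?_
    rw [Matrix.mul_one]
    refine hY₀ _ ?_
    have := exp_mul_injective ((-T) • A) (Y := 1) (fun x hx => by simpa using hx)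
      ((Y₀ * NormedSpace.exp (T • B)) *ᵥ x) (by rwa [Matrix.mul_one, Matrix.mulVec_mulVec])
    rwa [← Matrix.mulVec_mulVec] at this
  -- If `S` meets the column space of `Y₀`, that space is invariant under `A`, the backward flow
  -- never leaves it, and its limit `U` spans it.
  by_cases hinv : ∃ W ∈ S, W * Wᵀ = colProj Y₀
  · obtain ⟨W, hW, hWY⟩ := hinv
    have hW0 : (1 - colProj Y₀) * A * W = 0 := by
      rw [← hWY]; exact (hS.subset_equilibria hW).2
    have hprojY : colProj Y₀ * Y₀ = Y₀ := by
      rw [colProj, Matrix.mul_assoc, Matrix.mul_assoc, Matrix.nonsing_inv_mul _ hN₀,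
        Matrix.mul_one]
    have hAY : (1 - colProj Y₀) * (A * Y₀) = 0 := by
      have h1 : A * Y₀ = A * W * (Wᵀ * Y₀) := by
        rw [Matrix.mul_assoc, ← Matrix.mul_assoc W, hWY, hprojY]
      rw [h1, ← Matrix.mul_assoc, ← Matrix.mul_assoc (1 - _), hW0, Matrix.zero_mul]
    have hAY' : A * Y₀ = Y₀ * ((Y₀ᵀ * Y₀)⁻¹ * Y₀ᵀ * (A * Y₀)) := by
      rw [Matrix.sub_mul, Matrix.one_mul, sub_eq_zero] at hAY
      conv_lhs => rw [hAY, colProj]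
      simp only [Matrix.mul_assoc]
    have hkill : ∀ T, (1 - colProj Y₀) * Z T = 0 := by
      intro T
      have h1 := exp_mul_of_intertwine (A := (-T) • A) (X := Y₀)
        (B := (-T) • ((Y₀ᵀ * Y₀)⁻¹ * Y₀ᵀ * (A * Y₀)))
        (by rw [Matrix.smul_mul, Matrix.mul_smul, ← hAY'])
      simp only [hZ, h1]
      rw [← Matrix.mul_assoc, ← Matrix.mul_assoc, Matrix.sub_mul, Matrix.one_mul, hprojY, sub_self,
        Matrix.zero_mul, Matrix.zero_mul]
    have hkU : (1 - colProj Y₀) * U = 0 := by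
      have hc : Continuous fun X : Matrix (Fin n) (Fin r) ℝ => (1 - colProj Y₀) * X := by fun_prop
      have h1 := (hc.tendsto U).comp hlim
      refine tendsto_nhds_unique h1 ?_
      simp only [Function.comp_def, hkill]
      exact tendsto_const_nhds
    rw [Matrix.sub_mul, Matrix.one_mul, sub_eq_zero] at hkU
    set K := (Y₀ᵀ * Y₀)⁻¹ * Y₀ᵀ * U with hK
    have hUK : U = Y₀ * K := by
      conv_lhs => rw [hkU, colProj]
      simp only [hK, Matrix.mul_assoc]
    have h1 : (Uᵀ * Y₀) * K = 1 := by rw [Matrix.mul_assoc, ← hUK, hUst]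
    have h2 : K * (Uᵀ * Y₀) = 1 := mul_eq_one_comm.1 h1
    calc U * Uᵀ * Y₀ = Y₀ * (K * (Uᵀ * Y₀)) := by
          rw [← Matrix.mul_assoc, ← hUK, Matrix.mul_assoc]
      _ = Y₀ := by rw [h2, Matrix.mul_one]
  · exfalso
    push Not at hinv
    -- Otherwise, avoiding the column space of `Y₀` is an open condition satisfied on all of `S`, to
    -- which stability applies.
    have hN : {W : Matrix (Fin n) (Fin r) ℝ | W * Wᵀ ≠ colProj Y₀} ∈ 𝓝ˢ S := by
      refine (IsOpen.mem_nhdsSet ?_).2 hinv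
      exact isOpen_ne_fun (by fun_prop) continuous_const
    obtain ⟨N₀, hN₀S, hstab⟩ := hS.stable _ hN
    have hUN₀ : N₀ ∈ 𝓝 U := mem_nhdsSet_iff_forall.1 hN₀S U hU
    obtain ⟨P, hVst, hVlim⟩ := exists_orthonormalization hZpos hlim hUst
    obtain ⟨T, hT, hT0⟩ := ((hVlim.eventually hUN₀).and (Filter.eventually_ge_atTop 0)).exists
    obtain ⟨V, hV, hV0, hVt⟩ := exists_isOjaOrbit A ε (hVst T)
    -- Oja time `T * ε` is linear time `T`, which exactly undoes the backward flow: the orbit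
    -- arrives in the forbidden column space.
    have h1 := hstab V hV (hV0 ▸ hT) (T * ε) (by positivity)
    obtain ⟨h2, K, hK⟩ := hVt (T * ε)
    rw [mul_assoc, mul_inv_cancel₀ hε.ne', mul_one] at hK
    have h3 : V (T * ε) = Y₀ * (NormedSpace.exp (T • B) * P T * K) := by
      rw [hK, hZ]
      simp only [← Matrix.mul_assoc, hexpinv, Matrix.one_mul]
    rw [h3] at h1 h2
    exact h1 (mul_transpose_eq_colProj h2)

end OjaFlow

/-! ### Spectral dominance at stable equilibria. -/

section Dominance

lemma tendsto_pow_mul_exp_neg_mul {δ : ℝ} (hδ : 0 < δ) (j : ℕ) :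
    Filter.Tendsto (fun T : ℝ => T ^ j * Real.exp (-(T * δ))) Filter.atTop (𝓝 0) := by
  have h1 := (Real.tendsto_pow_mul_exp_neg_atTop_nhds_zero j).comp
    (Filter.tendsto_id.atTop_mul_const hδ)
  have h2 := h1.const_mul ((δ ^ j)⁻¹)
  rw [mul_zero] at h2
  refine h2.congr fun T => ?_
  simp only [Function.comp_apply, id_eq, mul_pow]
  field_simp

/-- Backward in time, generalized eigenvectors decay faster than exponentials with a smaller
rate. -/
lemma tendsto_exp_smul_mulVec {n : Type*} [Fintype n] [DecidableEq n] {N : Matrix n n ℂ}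
    {μ ν : ℂ} {k : ℕ} {v : n → ℂ} (h : (N - μ • 1) ^ k *ᵥ v = 0) (hlt : ν.re < μ.re) :
    Filter.Tendsto (fun T : ℝ => Complex.exp (T * ν) • NormedSpace.exp ((-T : ℂ) • N) *ᵥ v)
      Filter.atTop (𝓝 0) := by
  have h1 : ∀ j : ℕ, Filter.Tendsto (fun T : ℝ => Complex.exp (T * ν) * (Complex.exp (-T * μ) *
      ((-T) ^ j * (j.factorial : ℂ)⁻¹))) Filter.atTop (𝓝 0) := by
    intro j
    rw [tendsto_zero_iff_norm_tendsto_zero]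
    have h2 := (tendsto_pow_mul_exp_neg_mul (sub_pos.2 hlt) j).mul_const ((j.factorial : ℝ)⁻¹)
    rw [zero_mul] at h2
    refine h2.congr' ?_
    filter_upwards [Filter.eventually_ge_atTop 0] with T hT
    have h3 : -(T * (μ.re - ν.re)) = T * ν.re + -(T * μ.re) := by ring
    simp only [norm_mul, Complex.norm_exp, norm_pow, norm_neg, Complex.norm_real, norm_inv,
      Complex.norm_natCast, Real.norm_of_nonneg hT]
    rw [h3, Real.exp_add]
    simp
    ring
  have h4 : ∀ T : ℝ, Complex.exp (T * ν) • NormedSpace.exp ((-T : ℂ) • N) *ᵥ v =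
      ∑ j ∈ Finset.range k, (Complex.exp (T * ν) * (Complex.exp (-T * μ) *
        ((-T) ^ j * (j.factorial : ℂ)⁻¹))) • ((N - μ • 1) ^ j *ᵥ v) := by
    intro T
    rw [exp_smul_mulVec_of_pow_mulVec_eq_zero h, Finset.smul_sum, Finset.smul_sum]
    simp only [smul_smul]
  simp only [h4]
  have h5 := tendsto_finsetSum (Finset.range k) fun j _ =>
    (h1 j).smul_const ((N - μ • 1) ^ j *ᵥ v)
  simpa using h5

/-- The real part of the outer product of two complex vectors. -/
def reOuter {m n : Type*} (v : m → ℂ) (w : n → ℂ) : Matrix m n ℝ :=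
  Matrix.of fun i j => (v i * w j).re

lemma mul_reOuter {l m n : Type*} [Fintype m] (M : Matrix l m ℝ) (v : m → ℂ) (w : n → ℂ) :
    M * reOuter v w = reOuter (M.map (algebraMap ℝ ℂ) *ᵥ v) w := by
  ext i j
  simp only [reOuter, Matrix.mul_apply, Matrix.of_apply, Matrix.mulVec, dotProduct,
    Matrix.map_apply, Finset.sum_mul, Complex.re_sum, Complex.coe_algebraMap, mul_assoc,
    Complex.re_ofReal_mul]

lemma reOuter_mul {m n o : Type*} [Fintype n] (M : Matrix n o ℝ) (v : m → ℂ) (w : n → ℂ) :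
    reOuter v w * M = reOuter v (w ᵥ* M.map (algebraMap ℝ ℂ)) := by
  ext i j
  simp only [reOuter, Matrix.mul_apply, Matrix.of_apply, Matrix.vecMul, dotProduct,
    Matrix.map_apply, Finset.mul_sum, Complex.re_sum, Complex.coe_algebraMap, ← mul_assoc,
    Complex.re_mul_ofReal]

lemma reOuter_smul {m n : Type*} (c : ℂ) (v : m → ℂ) (w : n → ℂ) :
    reOuter v (c • w) = reOuter (c • v) w := by
  ext i j
  simp only [reOuter, Matrix.of_apply, Pi.smul_apply, smul_eq_mul]
  congr 1
  ring

lemma exp_smul_map_algebraMap {n : Type*} [Fintype n] [DecidableEq n] (A : Matrix n n ℝ) (t : ℝ) :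
    (NormedSpace.exp (t • A)).map (algebraMap ℝ ℂ) =
      NormedSpace.exp ((t : ℂ) • A.map (algebraMap ℝ ℂ)) := by
  rw [exp_map_algebraMap]
  congr 1
  ext i j
  simp

lemma vecMul_exp_of_vecMul_eq_smul {n : Type*} [Fintype n] [DecidableEq n] {N : Matrix n n ℂ}
    {ν : ℂ} {w : n → ℂ} (h : w ᵥ* N = ν • w) (t : ℂ) :
    w ᵥ* NormedSpace.exp (t • N) = Complex.exp (t * ν) • w := by
  rw [← Matrix.mulVec_transpose] at h ⊢
  rw [← Matrix.exp_transpose, Matrix.transpose_smul, exp_mulVec_of_mulVec_eq_smul h]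

lemma aeval_intertwine {m n : Type*} [Fintype m] [DecidableEq m] [Fintype n] [DecidableEq n]
    {N : Matrix n n ℂ} {M : Matrix m m ℂ} {X : Matrix m n ℂ} (h : X * N = M * X)
    (g : Polynomial ℂ) : X * Polynomial.aeval N g = Polynomial.aeval M g * X := by
  have hp : ∀ k : ℕ, X * N ^ k = M ^ k * X := by
    intro k
    induction k with
    | zero => simp
    | succ k ih => rw [pow_succ, ← Matrix.mul_assoc, ih, Matrix.mul_assoc, h, ← Matrix.mul_assoc,
        ← pow_succ]
  simp only [Polynomial.aeval_eq_sum_range, Matrix.mul_sum, Matrix.sum_mul, Matrix.mul_smul,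
    Matrix.smul_mul, hp]

lemma aeval_mulVec_of_mulVec_eq_smul {n : Type*} [Fintype n] [DecidableEq n]
    {N : Matrix n n ℂ} {μ : ℂ} {y : n → ℂ} (h : N *ᵥ y = μ • y) (g : Polynomial ℂ) :
    Polynomial.aeval N g *ᵥ y = g.eval μ • y := by
  have hp : ∀ k : ℕ, N ^ k *ᵥ y = μ ^ k • y := by
    intro k
    induction k with
    | zero => simp
    | succ k ih => rw [pow_succ', ← Matrix.mulVec_mulVec, ih, Matrix.mulVec_smul, h, smul_smul,
        ← pow_succ]
  simp only [Polynomial.aeval_eq_sum_range, Polynomial.eval_eq_sum_range, Matrix.sum_mulVec,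
    Matrix.smul_mulVec, hp, Finset.sum_smul, smul_smul]

/-- An eigenvector of a quotient lifts to a generalized eigenvector. -/
lemma exists_generalized_eigenvector {m n : Type*} [Fintype m] [DecidableEq m] [Fintype n]
    [DecidableEq n] {N : Matrix n n ℂ} {M : Matrix m m ℂ} {X : Matrix m n ℂ} {X' : Matrix n m ℂ}
    (hX : X * X' = 1) (h : X * N = M * X) {μ : ℂ} {y : m → ℂ} (hy : y ≠ 0)
    (hμ : M *ᵥ y = μ • y) :
    ∃ (v : n → ℂ) (k : ℕ), (N - μ • 1) ^ k *ᵥ v = 0 ∧ X *ᵥ v ≠ 0 := by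
  -- By Cayley–Hamilton, `g(N)` moves the lift of `y` into the generalized eigenspace of `μ`. Its
  -- image under `X` is `g(μ) • y`, which is nonzero because `X - μ` does not divide `g`.
  obtain ⟨g, hg, hdvd⟩ := N.charpoly.exists_eq_pow_rootMultiplicity_mul_and_not_dvd
    (Matrix.charpoly_monic N).ne_zero μ
  refine ⟨Polynomial.aeval N g *ᵥ (X' *ᵥ y), N.charpoly.rootMultiplicity μ, ?_, ?_⟩
  · have h1 := Matrix.aeval_self_charpoly N
    rw [hg, map_mul, map_pow, map_sub, Polynomial.aeval_X, Polynomial.aeval_C,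
      Algebra.algebraMap_eq_smul_one] at h1
    rw [Matrix.mulVec_mulVec, h1, Matrix.zero_mulVec]
  · rw [Matrix.mulVec_mulVec, Matrix.mulVec_mulVec, aeval_intertwine h, Matrix.mul_assoc, hX,
      Matrix.mul_one, aeval_mulVec_of_mulVec_eq_smul hμ]
    refine smul_ne_zero (fun h0 => hdvd ?_) hy
    exact Polynomial.dvd_iff_isRoot.2 h0

/-- At a stable equilibrium of the Oja flow, the spectrum on the column space lies to the right of
the spectrum on the complement. -/
lemma re_le_re_of_mem_stable {n r : ℕ} {A : Matrix (Fin n) (Fin n) ℝ} {ε : ℝ} (hε : 0 < ε)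
    {S : Set (Matrix (Fin n) (Fin r) ℝ)} (hS : IsAsymptoticallyStable A ε S)
    {U : Matrix (Fin n) (Fin r) ℝ} (hU : U ∈ S) (hAU : A * U = U * (Uᵀ * A * U))
    {V : Matrix (Fin n) (Fin (n - r)) ℝ} (hUV : Uᵀ * V = 0) (hV : Vᵀ * V = 1)
    (hsum : U * Uᵀ + V * Vᵀ = 1) {μ ν : ℂ} (hν : ν ∈ eigenvalues (Uᵀ * A * U))
    (hμ : μ ∈ eigenvalues (Vᵀ * A * V)) : μ.re ≤ ν.re := by
  by_contra! hlt
  have hVU : Vᵀ * U = 0 := by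
    have := congrArg Matrix.transpose hUV
    simpa using this
  have hVA : Vᵀ * A = Vᵀ * A * V * Vᵀ := by
    have h1 : Vᵀ * A * U = 0 := by
      rw [Matrix.mul_assoc, hAU, ← Matrix.mul_assoc, hVU, Matrix.zero_mul]
    calc Vᵀ * A = Vᵀ * A * (U * Uᵀ + V * Vᵀ) := by rw [hsum, Matrix.mul_one]
      _ = Vᵀ * A * U * Uᵀ + Vᵀ * A * V * Vᵀ := by rw [Matrix.mul_add]; simp only [Matrix.mul_assoc]
      _ = _ := by rw [h1, Matrix.zero_mul, zero_add]
  obtain ⟨w, hw0, hw⟩ := mem_eigenvalues_iff_vecMul.1 hν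
  obtain ⟨y, hy0, hy⟩ := mem_eigenvalues_iff_mulVec.1 hμ
  have hc : ∀ {a b c : ℕ} (M : Matrix (Fin a) (Fin b) ℝ) (L : Matrix (Fin b) (Fin c) ℝ),
      (M * L).map (algebraMap ℝ ℂ) = M.map (algebraMap ℝ ℂ) * L.map (algebraMap ℝ ℂ) :=
    fun M L => Matrix.map_mul
  obtain ⟨v, k, hvk, hv0⟩ := exists_generalized_eigenvector
    (N := A.map (algebraMap ℝ ℂ)) (X := Vᵀ.map (algebraMap ℝ ℂ)) (X' := V.map (algebraMap ℝ ℂ))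
    (by rw [← hc, hV]; simp) (by rw [← hc, ← hc, ← hVA]) hy0 hy
  obtain ⟨i₀, hi₀⟩ := Function.ne_iff.1 hv0
  obtain ⟨j₀, hj₀⟩ := Function.ne_iff.1 hw0
  set a := (Vᵀ.map (algebraMap ℝ ℂ) *ᵥ v) i₀ * w j₀ with ha
  have ha0 : a ≠ 0 := mul_ne_zero hi₀ hj₀
  -- This complex scaling makes the `(i₀, j₀)` entry of `Vᵀ * Z₀` equal to one, so taking real parts
  -- cannot destroy the perturbation.
  set v' : Fin n → ℂ := a⁻¹ • v with hv'
  have hvk' : (A.map (algebraMap ℝ ℂ) - μ • 1) ^ k *ᵥ v' = 0 := by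
    rw [hv', Matrix.mulVec_smul, hvk, smul_zero]
  set Z₀ := reOuter v' w with hZ₀
  have hUexp : ∀ T : ℝ, NormedSpace.exp ((-T) • A) * U * NormedSpace.exp (T • (Uᵀ * A * U)) = U := by
    intro T
    rw [exp_mul_of_intertwine (X := U) (B := (-T) • (Uᵀ * A * U))
      (by rw [Matrix.smul_mul, hAU, Matrix.mul_smul]), Matrix.mul_assoc,
      ← exp_add_of_commute _ _ (((Commute.refl _).smul_left _).smul_right _), ← add_smul,
      neg_add_cancel, zero_smul, NormedSpace.exp_zero, Matrix.mul_one]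
  have hZexp : ∀ T : ℝ, NormedSpace.exp ((-T) • A) * Z₀ * NormedSpace.exp (T • (Uᵀ * A * U)) =
      reOuter (Complex.exp (T * ν) •
        NormedSpace.exp ((-T : ℂ) • A.map (algebraMap ℝ ℂ)) *ᵥ v') w := by
    intro T
    rw [hZ₀, mul_reOuter, reOuter_mul, exp_smul_map_algebraMap, exp_smul_map_algebraMap,
      vecMul_exp_of_vecMul_eq_smul hw, reOuter_smul, Complex.ofReal_neg]
  -- The right factor fixes `U` exactly and multiplies the perturbation by `exp (T ν)`, which loses
  -- against its backward decay at rate `μ`.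
  have hlim : Filter.Tendsto (fun T : ℝ => NormedSpace.exp ((-T) • A) * (U + Z₀) *
      NormedSpace.exp (T • (Uᵀ * A * U))) Filter.atTop (𝓝 U) := by
    simp only [Matrix.mul_add, Matrix.add_mul, hUexp, hZexp]
    have hcont : Continuous fun x : Fin n → ℂ => U + reOuter x w := by
      refine continuous_const.add (continuous_matrix fun i j => ?_)
      simp only [reOuter, Matrix.of_apply]
      fun_prop
    have h1 := (hcont.tendsto 0).comp (tendsto_exp_smul_mulVec hvk' hlt)
    have h2 : U + reOuter 0 w = U := by
      ext i j
      simp [reOuter]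
    rwa [h2] at h1
  have h1 := mul_transpose_mul_eq_of_tendsto hε hS hU _ hlim
  have h2 : Vᵀ * Z₀ = 0 := by
    have : Vᵀ * (U * Uᵀ * (U + Z₀)) = Vᵀ * (U + Z₀) := congrArg (fun X => Vᵀ * X) h1
    rw [← Matrix.mul_assoc, ← Matrix.mul_assoc, hVU, Matrix.zero_mul, Matrix.zero_mul,
      Matrix.mul_add, hVU, zero_add] at this
    exact this.symm
  have h3 := congrFun (congrFun h2 i₀) j₀
  rw [hZ₀, mul_reOuter, hv', Matrix.mulVec_smul] at h3
  simp only [reOuter, Matrix.of_apply, Pi.smul_apply, smul_eq_mul, Matrix.zero_apply,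
    mul_assoc, ← ha, inv_mul_cancel₀ ha0, Complex.one_re] at h3
  exact one_ne_zero h3

end Dominance

/-! ### Data inherited by the reduced filter. -/

section Filter

variable {n p r : ℕ}

/-- Observability is inherited by invariant subspaces. -/
lemma exists_sum_vecMul_of_isObservable {Ad : Matrix (Fin n) (Fin n) ℝ}
    {C : Matrix (Fin p) (Fin n) ℝ} (hobs : IsObservable Ad C) {U : Matrix (Fin n) (Fin r) ℝ}
    (hU : Uᵀ * U = 1) (hAU : Ad * U = U * (Uᵀ * Ad * U)) (y : Fin r → ℝ) :
    ∃ u : ℕ → Fin p → ℝ,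
      y = ∑ k ∈ Finset.range n, u k ᵥ* (C * U * (Uᵀ * Ad * U) ^ k) := by
  obtain ⟨L, hL⟩ := exists_leftInverse_of_rank_eq hobs
  have hp : ∀ k : ℕ, C * U * (Uᵀ * Ad * U) ^ k = C * Ad ^ k * U := by
    have : ∀ k : ℕ, U * (Uᵀ * Ad * U) ^ k = Ad ^ k * U := by
      intro k
      induction k with
      | zero => simp
      | succ k ih => rw [pow_succ, ← Matrix.mul_assoc, ih, Matrix.mul_assoc, ← hAU,
          ← Matrix.mul_assoc, ← pow_succ]
    intro k
    rw [Matrix.mul_assoc, this, Matrix.mul_assoc]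
  set u' : Fin n × Fin p → ℝ := (y ᵥ* Uᵀ) ᵥ* L with hu'
  -- The controls are the blocks of the lifted vector `y ᵥ* Uᵀ` times a left inverse of the
  -- observability matrix; the default zero is never summed.
  refine ⟨fun k j => if h : k < n then u' (⟨k, h⟩, j) else 0, ?_⟩
  have h1 : y = (u' ᵥ* Matrix.of fun (ki : Fin n × Fin p) (j : Fin n) =>
      (C * Ad ^ (ki.1 : ℕ)) ki.2 j) ᵥ* U := by
    rw [hu', Matrix.vecMul_vecMul _ L, hL, Matrix.vecMul_one, Matrix.vecMul_vecMul, hU,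
      Matrix.vecMul_one]
  have h2 : (u' ᵥ* Matrix.of fun (ki : Fin n × Fin p) (j : Fin n) =>
      (C * Ad ^ (ki.1 : ℕ)) ki.2 j) =
      ∑ k : Fin n, (fun j => u' (k, j)) ᵥ* (C * Ad ^ (k : ℕ)) := by
    ext j
    simp only [Matrix.vecMul, dotProduct, Matrix.of_apply, Finset.sum_apply,
      Fintype.sum_prod_type]
  rw [Finset.sum_range]
  simp only [Fin.is_lt, dif_pos, Fin.eta, hp]
  rw [h1, h2, Matrix.sum_vecMul]
  simp only [Matrix.vecMul_vecMul]

lemma posDef_transpose_mul_mul {W : Matrix (Fin n) (Fin n) ℝ} (hW : W.PosDef)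
    {U : Matrix (Fin n) (Fin r) ℝ} (hU : Uᵀ * U = 1) : (Uᵀ * W * U).PosDef := by
  have h1 := hW.posSemidef.conjTranspose_mul_mul_same U
  rw [Matrix.conjTranspose_eq_transpose_of_trivial] at h1
  refine Matrix.PosDef.of_dotProduct_mulVec_pos h1.isHermitian fun x hx => ?_
  have h2 := quad_pos hW (x := U *ᵥ x) fun h => hx (injective_of_transpose_mul_self hU x h)
  rw [quad, ← Matrix.vecMul_transpose, ← Matrix.dotProduct_mulVec, Matrix.vecMul_transpose,
    Matrix.mulVec_mulVec, Matrix.mulVec_mulVec] at h2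
  rwa [star_trivial]

lemma posDef_mul_transpose {H : Matrix (Fin p) (Fin p) ℝ} (hH : H.det ≠ 0) :
    (H * Hᵀ).PosDef := by
  have := posDef_transpose_mul_self (Y := Hᵀ) fun x hx =>
    Matrix.eq_zero_of_mulVec_eq_zero (by rwa [Matrix.det_transpose]) hx
  rwa [Matrix.transpose_transpose] at this

end Filter

end LowRankKalman

/-! ### Assembly of the theorem. -/

open LowRankKalman in
theorem mainTheorem1 {n q p r : ℕ}
    (A : Matrix (Fin n) (Fin n) ℝ) (G : Matrix (Fin n) (Fin q) ℝ)
    (C : Matrix (Fin p) (Fin n) ℝ) (H : Matrix (Fin p) (Fin p) ℝ) (h ε : ℝ)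
    (hh : 0 < h) (hH : H.det ≠ 0) (hε0 : 0 < ε) (hε1 : ε ≤ 1)
    (hr1 : 1 ≤ r) (hrn : r < n)
    (hgap : LowRankKalman.reEigenvalue A (r + 1) < LowRankKalman.reEigenvalue A r)
    (hreach : LowRankKalman.IsReachable (LowRankKalman.discA A h) (LowRankKalman.discG A G h))
    (hobs : LowRankKalman.IsObservable (LowRankKalman.discA A h) C)
    (r' : ℕ) (hr' : LowRankKalman.numHurwitzUnstable A = r')
    (U : Matrix (Fin n) (Fin r) ℝ) (hU : U ∈ LowRankKalman.ojaStableSet r A ε) :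
    (∃! R : Matrix (Fin r) (Fin r) ℝ, LowRankKalman.IsSteadyState
      (LowRankKalman.discA A h) (LowRankKalman.discG A G h) C H U R) ∧
    ∀ R : Matrix (Fin r) (Fin r) ℝ, LowRankKalman.IsSteadyState
      (LowRankKalman.discA A h) (LowRankKalman.discG A G h) C H U R →
      (LowRankKalman.IsSchurStable (LowRankKalman.closedLoop (LowRankKalman.discA A h) C U
        (LowRankKalman.lowRankGain C H U R)) ↔ r' ≤ r) := by
  obtain ⟨S, hS, hUS⟩ := hU
  obtain ⟨hUst, hUeq⟩ := hS.subset_equilibria hUS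
  replace hUst : Uᵀ * U = 1 := hUst
  have hAU : A * U = U * (Uᵀ * A * U) := by
    rw [ojaField, Matrix.sub_mul, Matrix.sub_mul, Matrix.one_mul, sub_eq_zero] at hUeq
    rw [hUeq]
    simp only [Matrix.mul_assoc]
  obtain ⟨V, hUV, hV, hsum⟩ := exists_orthonormal_completion hrn.le hUst
  have hVU : Vᵀ * U = 0 := by
    have := congrArg Matrix.transpose hUV
    simpa using this
  have hVAU : Vᵀ * A * U = 0 := by
    rw [Matrix.mul_assoc, hAU, ← Matrix.mul_assoc, hVU, Matrix.zero_mul]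
  have hVA : Vᵀ * A = Vᵀ * A * V * Vᵀ := by
    calc Vᵀ * A = Vᵀ * A * (U * Uᵀ + V * Vᵀ) := by rw [hsum, Matrix.mul_one]
      _ = Vᵀ * A * U * Uᵀ + Vᵀ * A * V * Vᵀ := by rw [Matrix.mul_add]; simp only [Matrix.mul_assoc]
      _ = _ := by rw [hVAU, Matrix.zero_mul, zero_add]
  have hdU : discA A h * U = U * NormedSpace.exp (h • (Uᵀ * A * U)) :=
    exp_mul_of_intertwine (by rw [Matrix.smul_mul, hAU, Matrix.mul_smul])
  have hdV : Vᵀ * discA A h = discA (Vᵀ * A * V) h * Vᵀ :=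
    (exp_mul_of_intertwine (by rw [Matrix.smul_mul, ← hVA, Matrix.mul_smul])).symm
  have hdU' : discA A h * U = U * (Uᵀ * discA A h * U) := by
    rw [Matrix.mul_assoc Uᵀ, hdU, ← Matrix.mul_assoc Uᵀ, hUst, Matrix.one_mul]
  have hdVU : Vᵀ * discA A h * U = 0 := by
    rw [hdV, Matrix.mul_assoc, hVU, Matrix.mul_zero]
  have hdVV : Vᵀ * discA A h * V = discA (Vᵀ * A * V) h := by
    rw [hdV, Matrix.mul_assoc, hV, Matrix.mul_one]
  have hM := posDef_mul_transpose hH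
  have hQ : ((Uᵀ * discG A G h) * (Uᵀ * discG A G h)ᵀ).PosDef := by
    have h1 := posDef_transpose_mul_mul (noiseCov_posDef hh hreach) hUst
    rw [← discG_mul_transpose hh.le] at h1
    simpa only [Matrix.transpose_mul, Matrix.transpose_transpose, Matrix.mul_assoc] using h1
  -- By definition, `IsSteadyState` is the equation `riccati` for the reduced matrices.
  refine ⟨existsUnique_riccati hM hQ n (exists_sum_vecMul_of_isObservable hobs hUst hdU'),
    fun R hR => ?_⟩
  obtain ⟨hRpos, hRfix⟩ := hR
  set F := lowRankGain C H U R with hF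
  have hKU : closedLoop (discA A h) C U F * U = discA A h * U * (1 - F * (C * U)) := by
    simp only [closedLoop, Matrix.mul_sub, Matrix.sub_mul, Matrix.mul_one, Matrix.mul_assoc]
  have hVKU : Vᵀ * closedLoop (discA A h) C U F * U = 0 := by
    rw [Matrix.mul_assoc, hKU, ← Matrix.mul_assoc, ← Matrix.mul_assoc, hdVU, Matrix.zero_mul]
  have hUKU : Uᵀ * closedLoop (discA A h) C U F * U = Uᵀ * discA A h * U -
      optGain (Uᵀ * discA A h * U) (C * U) (H * Hᵀ) R * (C * U) := by
    rw [Matrix.mul_assoc, hKU, ← Matrix.mul_assoc, ← Matrix.mul_assoc, Matrix.mul_sub,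
      Matrix.mul_one, ← Matrix.mul_assoc _ F]
    rfl
  -- The gain enters only through the factor `Vᵀ * discA A h * U = 0`, so the complement runs in
  -- open loop.
  have hVKV : Vᵀ * closedLoop (discA A h) C U F * V = discA (Vᵀ * A * V) h := by
    rw [closedLoop, Matrix.mul_sub, Matrix.mul_one, Matrix.mul_sub, Matrix.sub_mul, hdVV,
      ← Matrix.mul_assoc, ← Matrix.mul_assoc, ← Matrix.mul_assoc, hdVU]
    simp
  have heigA := eigenvalues_eq_add hrn.le hsum hVAU
  have heigK := eigenvalues_eq_add hrn.le hsum hVKU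
  rw [hUKU, hVKV] at heigK
  have hstab : IsSchurStable (closedLoop (discA A h) C U F) ↔
      IsSchurStable (discA (Vᵀ * A * V) h) := by
    rw [IsSchurStable, heigK]
    refine ⟨fun H z hz => H z (Multiset.mem_add.2 (Or.inr hz)), fun H z hz => ?_⟩
    rcases Multiset.mem_add.1 hz with hz | hz
    · obtain ⟨w, hw0, hw⟩ := mem_eigenvalues_iff_vecMul.1 hz
      exact norm_lt_one_of_riccati hM hQ hRpos.posSemidef hRfix hw0 hw
    · exact H z hz
  obtain ⟨c, hc⟩ := exists_countP_eq_of_sort_gap ((eigenvalues A).map Complex.re) hr1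
    (by rw [Multiset.card_map, card_eigenvalues]; exact hrn) hgap
  rw [Multiset.countP_map, ← Multiset.countP_eq_card_filter, heigA] at hc
  rw [hstab, isSchurStable_discA_iff hh, ← hr', numHurwitzUnstable, heigA]
  refine forall_re_neg_iff (card_eigenvalues _) (c := c) (by convert hc) fun ν hν μ hμ => ?_
  exact re_le_re_of_mem_stable hε0 hS hUS hAU hUV hV hsum hν hμ
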